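/- Let $\beta_n,\alpha_n^L,\alpha_n^R$ ($n\ge 0$) be complex polynomials of degree at most $1$, not identically zero, with uniformly bounded coefficients. Let $A,B$ be the infinite tridiagonal matrices such that the pencil $zB-A$ has the entries $\beta_n(z)$ at $(n,n)$, $-\alpha_n^R(z)$ at $(n,n+1)$, $-\alpha_n^L(z)$ at $(n+1,n)$ and $0$ elsewhere; they act as bounded operators on $\ell^2=\ell^2(\{0,1,2,\dots\})$. Let $\rho(A,B)$ be the set of $z\in\mathbb C$ such that $zB-A$ has a bounded inverse, where in addition the point $\infty$ of the extended plane $\overline{\mathbb C}$ is counted in $\rho(A,B)$ if and only if $B$ has a bounded inverse, and let $m(z)=\langle (zB-A)^{-1}e_0,e_0\rangle$ for finite $z\in\rho(A,B)$. Define $q_0=1$, $q_1=\beta_0$, $q_{n+1}=\beta_nq_n-\alpha_{n-1}^L\alpha_{n-1}^Rq_{n-1}$ for $n\ge1$, and $$q_n^R=\frac{q_n}{\alpha_0^R\cdots\alpha_{n-1}^R},\qquad q_n^L=\frac{q_n}{\alpha_0^L\cdots\alpha_{n-1}^L}.$$ Let $\Gamma_{ext}\subset\overline{\mathbb C}$ be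 a domain (open, connected, non-empty) whose boundary is a rectifiable Jordan curve $\Gamma\subset\mathbb C$, oriented such that $\Gamma_{ext}$ lies on the right of $\Gamma$. Suppose that $\Gamma_{ext}$ contains the roots of all $\alpha_k^L$ and all $\alpha_k^R$, $k\ge 0$ (the root being $\infty$ if the polynomial is constant), and that the closure of $\Gamma_{ext}$ in $\overline{\mathbb C}$ is contained in $\rho(A,B)$. Then $$\mathfrak S(g)=\frac1{2\pi i}\int_\Gamma g(\zeta)\,m(\zeta)\,d\zeta,\qquad g\in\mathcal C(\Gamma),$$ is a well-defined linear functional, and for every $n\ge1$ and every polynomial $p$ of degree $<n$ the functions below are continuous on $\Gamma$ and $$\mathfrak S\Bigl(q_n^R\,\frac{p}{\alpha_0^L\alpha_1^L\cdots\alpha_{n-1}^L}\Bigr)=0,\qquad \mathfrak S\Bigl(\frac{p}{\alpha_0^R\alpha_1^R\cdots\alpha_{n-1}^R}\,q_n^L\Bigr)=0.$$ -/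

import Mathlib

open Polynomial Set MeasureTheory

noncomputable section

namespace MPPencil

/-! ### Bounded tridiagonal matrices as operators on the Hilbert space of square summable sequences -/

/-- The Hilbert space of complex square summable sequences `(x₀, x₁, …)`. -/
abbrev L2 : Type := lp (fun _ : ℕ => ℂ) 2

/-- The infinite matrix `M` is tridiagonal. -/
def IsTridiagonal (M : Matrix ℕ ℕ ℂ) : Prop :=
  ∀ i j : ℕ, i + 1 < j ∨ j + 1 < i → M i j = 0

/-- The entries of the infinite matrix `M` are bounded. -/
def HasBoundedEntries (M : Matrix ℕ ℕ ℂ) : Prop :=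
  ∃ C : ℝ, ∀ i j : ℕ, ‖M i j‖ ≤ C

/-- The usual product of an infinite matrix and a column vector (a finite sum in each row if the
matrix is tridiagonal). -/
def mulVec (M : Matrix ℕ ℕ ℂ) (x : ℕ → ℂ) (i : ℕ) : ℂ := ∑' j, M i j * x j

lemma mulVec_eq_sum {M : Matrix ℕ ℕ ℂ} (hM : IsTridiagonal M) (x : ℕ → ℂ) (i : ℕ) :
    mulVec M x i = ∑ j ∈ Finset.Icc (i - 1) (i + 1), M i j * x j := by
  refine tsum_eq_sum fun j hj => ?_
  rw [Finset.mem_Icc] at hj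
  rw [hM i j (by omega), zero_mul]

lemma sq_norm_mulVec_le {M : Matrix ℕ ℕ ℂ} (hM : IsTridiagonal M) {C : ℝ}
    (hC : ∀ i j, ‖M i j‖ ≤ C) (x : ℕ → ℂ) (i : ℕ) :
    ‖mulVec M x i‖ ^ 2 ≤ 3 * C ^ 2 * (‖x (i - 1)‖ ^ 2 + ‖x i‖ ^ 2 + ‖x (i + 1)‖ ^ 2) := by
  have hC0 : 0 ≤ C := (norm_nonneg _).trans (hC 0 0)
  have hsub : Finset.Icc (i - 1) (i + 1) ⊆ ({i - 1, i, i + 1} : Finset ℕ) := by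
    intro j hj
    simp only [Finset.mem_Icc, Finset.mem_insert, Finset.mem_singleton] at hj ⊢
    omega
  have h1 : ‖mulVec M x i‖ ≤ C * (‖x (i - 1)‖ + ‖x i‖ + ‖x (i + 1)‖) := by
    rw [mulVec_eq_sum hM]
    calc ‖∑ j ∈ Finset.Icc (i - 1) (i + 1), M i j * x j‖
        ≤ ∑ j ∈ Finset.Icc (i - 1) (i + 1), C * ‖x j‖ := by
          refine norm_sum_le_of_le _ fun j _ => ?_
          rw [norm_mul]
          exact mul_le_mul_of_nonneg_right (hC i j) (norm_nonneg _)
      _ ≤ ∑ j ∈ ({i - 1, i, i + 1} : Finset ℕ), C * ‖x j‖ :=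
          Finset.sum_le_sum_of_subset_of_nonneg hsub fun _ _ _ => by positivity
      _ ≤ C * (‖x (i - 1)‖ + ‖x i‖ + ‖x (i + 1)‖) := by
          have key : ∀ (f : ℕ → ℝ), (∀ j, 0 ≤ f j) → ∀ a b c : ℕ,
              ∑ j ∈ ({a, b, c} : Finset ℕ), f j ≤ f a + f b + f c := by
            intro f hf a b c
            have e1 : ∑ j ∈ ({b, c} : Finset ℕ), f j ≤ f b + f c := by
              by_cases hb : b ∈ ({c} : Finset ℕ)
              · rw [Finset.insert_eq_of_mem hb, Finset.sum_singleton]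
                linarith [hf b]
              · rw [Finset.sum_insert hb, Finset.sum_singleton]
            by_cases ha : a ∈ ({b, c} : Finset ℕ)
            · rw [Finset.insert_eq_of_mem ha]
              linarith [hf a]
            · rw [Finset.sum_insert ha]
              linarith
          have := key (fun j => C * ‖x j‖) (fun j => by positivity) (i - 1) i (i + 1)
          calc _ ≤ _ := this
            _ = _ := by ring
  have h2 := pow_le_pow_left₀ (norm_nonneg _) h1 2
  refine h2.trans ?_
  rw [mul_pow, mul_comm 3 (C ^ 2), mul_assoc]
  refine mul_le_mul_of_nonneg_left ?_ (sq_nonneg C)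
  nlinarith [sq_nonneg (‖x (i - 1)‖ - ‖x i‖), sq_nonneg (‖x (i - 1)‖ - ‖x (i + 1)‖),
    sq_nonneg (‖x i‖ - ‖x (i + 1)‖)]

lemma sum_sq_norm_mulVec_le {M : Matrix ℕ ℕ ℂ} (hM : IsTridiagonal M) {C : ℝ}
    (hC : ∀ i j, ‖M i j‖ ≤ C) (x : L2) (s : Finset ℕ) :
    ∑ i ∈ s, ‖mulVec M x i‖ ^ 2 ≤ (4 * C * ‖x‖) ^ 2 := by
  have hx : ∀ t : Finset ℕ, ∑ i ∈ t, ‖x i‖ ^ 2 ≤ ‖x‖ ^ 2 := by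
    intro t
    have := lp.sum_rpow_le_norm_rpow (p := 2) (by norm_num) x t
    simpa using this
  obtain ⟨N, hN⟩ := s.exists_nat_subset_range
  have hs : s ⊆ Finset.range (N + 1) := hN.trans (Finset.range_mono (Nat.le_succ N))
  have e0 : ‖x 0‖ ^ 2 ≤ ‖x‖ ^ 2 := by simpa using hx {0}
  have e1 : ∑ i ∈ Finset.range (N + 1), ‖x (i - 1)‖ ^ 2 ≤ 2 * ‖x‖ ^ 2 := by
    rw [Finset.sum_range_succ']
    simp only [Nat.add_sub_cancel, Nat.zero_sub]
    linarith [hx (Finset.range N)]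
  have e2 := hx (Finset.range (N + 1))
  have e3 : ∑ i ∈ Finset.range (N + 1), ‖x (i + 1)‖ ^ 2 ≤ ‖x‖ ^ 2 := by
    have := hx (Finset.range (N + 2))
    rw [Finset.sum_range_succ'] at this
    linarith [sq_nonneg ‖x 0‖]
  calc ∑ i ∈ s, ‖mulVec M x i‖ ^ 2
      ≤ ∑ i ∈ Finset.range (N + 1), ‖mulVec M x i‖ ^ 2 :=
        Finset.sum_le_sum_of_subset_of_nonneg hs fun _ _ _ => by positivity
    _ ≤ ∑ i ∈ Finset.range (N + 1),
          3 * C ^ 2 * (‖x (i - 1)‖ ^ 2 + ‖x i‖ ^ 2 + ‖x (i + 1)‖ ^ 2) :=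
        Finset.sum_le_sum fun i _ => sq_norm_mulVec_le hM hC x i
    _ = 3 * C ^ 2 * (∑ i ∈ Finset.range (N + 1), ‖x (i - 1)‖ ^ 2
          + ∑ i ∈ Finset.range (N + 1), ‖x i‖ ^ 2
          + ∑ i ∈ Finset.range (N + 1), ‖x (i + 1)‖ ^ 2) := by
        rw [← Finset.mul_sum, Finset.sum_add_distrib, Finset.sum_add_distrib]
    _ ≤ 3 * C ^ 2 * (4 * ‖x‖ ^ 2) := by
        refine mul_le_mul_of_nonneg_left (by linarith) (by positivity)
    _ ≤ (4 * C * ‖x‖) ^ 2 := by nlinarith [sq_nonneg (C * ‖x‖)]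

lemma memℓp_mulVec {M : Matrix ℕ ℕ ℂ} (hM : IsTridiagonal M) (hb : HasBoundedEntries M)
    (x : L2) : Memℓp (mulVec M x) 2 := by
  obtain ⟨C, hC⟩ := hb
  refine memℓp_gen' (C := (4 * C * ‖x‖) ^ 2) fun s => ?_
  simpa using sum_sq_norm_mulVec_le hM hC x s

/-- The bounded operator on `ℓ²` given by a tridiagonal matrix with bounded entries via the usual
matrix product. -/
def tridiagOp (M : Matrix ℕ ℕ ℂ) (hM : IsTridiagonal M) (hb : HasBoundedEntries M) :
    L2 →L[ℂ] L2 :=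
  LinearMap.mkContinuousOfExistsBound
    { toFun := fun x => ⟨mulVec M x, memℓp_mulVec hM hb x⟩
      map_add' := fun x y => by
        ext i
        change mulVec M (⇑(x + y)) i = mulVec M x i + mulVec M y i
        simp only [mulVec_eq_sum hM, lp.coeFn_add, Pi.add_apply, mul_add,
          Finset.sum_add_distrib]
      map_smul' := fun c x => by
        ext i
        change mulVec M (⇑(c • x)) i = c * mulVec M x i
        simp only [mulVec_eq_sum hM, lp.coeFn_smul, Pi.smul_apply, smul_eq_mul,
          Finset.mul_sum]
        exact Finset.sum_congr rfl fun _ _ => by ring }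
    (by
      obtain ⟨C, hC⟩ := hb
      have hC0 : 0 ≤ C := (norm_nonneg _).trans (hC 0 0)
      refine ⟨4 * C, fun x => ?_⟩
      refine lp.norm_le_of_forall_sum_le (by norm_num) (by positivity) fun s => ?_
      simpa using sum_sq_norm_mulVec_le hM hC x s)

lemma tridiagOp_apply (M : Matrix ℕ ℕ ℂ) (hM : IsTridiagonal M) (hb : HasBoundedEntries M)
    (x : L2) (i : ℕ) : tridiagOp M hM hb x i = ∑' j, M i j * x j := rfl

end MPPencil

/-! ### The continued fraction and its linear pencil -/

/-- The coefficients of a bounded continued fraction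
`1/β₀ - α₀ᴸα₀ᴿ/β₁ - α₁ᴸα₁ᴿ/β₂ - …`: polynomials of degree at most one, not identically zero, such
that the entries of the matrices `A` and `B` of the pencil `z B - A` are bounded. -/
structure MPFraction where
  β : ℕ → ℂ[X]
  αL : ℕ → ℂ[X]
  αR : ℕ → ℂ[X]
  β_ne_zero : ∀ n, β n ≠ 0
  αL_ne_zero : ∀ n, αL n ≠ 0
  αR_ne_zero : ∀ n, αR n ≠ 0
  β_natDegree_le : ∀ n, (β n).natDegree ≤ 1
  αL_natDegree_le : ∀ n, (αL n).natDegree ≤ 1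
  αR_natDegree_le : ∀ n, (αR n).natDegree ≤ 1
  bounded : ∃ C : ℝ, ∀ n i, ‖(β n).coeff i‖ ≤ C ∧ ‖(αL n).coeff i‖ ≤ C ∧ ‖(αR n).coeff i‖ ≤ C

namespace MPFraction

open MPPencil

variable (F : MPFraction)

/-- The denominators of the convergents: `q₀ = 1`, `q₁ = β₀` and
`q_{n+1} = β_n q_n - α_{n-1}ᴸ α_{n-1}ᴿ q_{n-1}` for `n ≥ 1`. -/
def q : ℕ → ℂ[X]
  | 0 => 1
  | 1 => F.β 0
  | (n + 2) => F.β (n + 1) * q (n + 1) - F.αL n * F.αR n * q n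

/-- The rational function `q_nᴿ = q_n / (α_0ᴿ ⋯ α_{n-1}ᴿ)`. -/
def qR (n : ℕ) (z : ℂ) : ℂ := (F.q n).eval z / ∏ k ∈ Finset.range n, (F.αR k).eval z

/-- The rational function `q_nᴸ = q_n / (α_0ᴸ ⋯ α_{n-1}ᴸ)`. -/
def qL (n : ℕ) (z : ℂ) : ℂ := (F.q n).eval z / ∏ k ∈ Finset.range n, (F.αL k).eval z

/-- The entries of the tridiagonal pencil `z B - A`, as polynomials in `z`: `β_n` on the diagonal,
`-α_nᴿ` at `(n, n+1)` and `-α_nᴸ` at `(n+1, n)`. -/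
def entry (i j : ℕ) : ℂ[X] :=
  if i = j then F.β i else if j = i + 1 then -F.αR i else if i = j + 1 then -F.αL j else 0

/-- The matrix `A` of the pencil `z B - A`. -/
def matA : Matrix ℕ ℕ ℂ := fun i j => -(F.entry i j).coeff 0

/-- The matrix `B` of the pencil `z B - A`. -/
def matB : Matrix ℕ ℕ ℂ := fun i j => (F.entry i j).coeff 1

lemma eval_entry (i j : ℕ) (z : ℂ) :
    (F.entry i j).eval z = z * F.matB i j - F.matA i j := by
  have h : (F.entry i j).natDegree ≤ 1 := by
    unfold entry
    split_ifs
    · exact F.β_natDegree_le i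
    · rw [natDegree_neg]; exact F.αR_natDegree_le i
    · rw [natDegree_neg]; exact F.αL_natDegree_le j
    · simp
  conv_lhs => rw [eq_X_add_C_of_natDegree_le_one h]
  simp only [matA, matB, eval_add, eval_mul, eval_C, eval_X]
  ring

lemma entry_eq_zero {i j : ℕ} (h : i + 1 < j ∨ j + 1 < i) : F.entry i j = 0 := by
  unfold entry
  rw [if_neg (by omega), if_neg (by omega), if_neg (by omega)]

lemma exists_norm_coeff_entry_le : ∃ C : ℝ, ∀ i j k : ℕ, ‖(F.entry i j).coeff k‖ ≤ C := by
  obtain ⟨C, hC⟩ := F.bounded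
  refine ⟨C, fun i j k => ?_⟩
  unfold entry
  split_ifs
  · exact (hC i k).1
  · rw [coeff_neg, norm_neg]; exact (hC i k).2.2
  · rw [coeff_neg, norm_neg]; exact (hC j k).2.1
  · rw [coeff_zero, norm_zero]; exact (norm_nonneg _).trans (hC 0 0).1

lemma isTridiagonal_matA : IsTridiagonal F.matA := fun i j h => by
  simp [matA, F.entry_eq_zero h]

lemma isTridiagonal_matB : IsTridiagonal F.matB := fun i j h => by
  simp [matB, F.entry_eq_zero h]

lemma hasBoundedEntries_matA : HasBoundedEntries F.matA := by
  obtain ⟨C, hC⟩ := F.exists_norm_coeff_entry_le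
  exact ⟨C, fun i j => by rw [matA, norm_neg]; exact hC i j 0⟩

lemma hasBoundedEntries_matB : HasBoundedEntries F.matB := by
  obtain ⟨C, hC⟩ := F.exists_norm_coeff_entry_le
  exact ⟨C, fun i j => hC i j 1⟩

/-- The bounded operator `A` on `ℓ²`. -/
def opA : L2 →L[ℂ] L2 := tridiagOp F.matA F.isTridiagonal_matA F.hasBoundedEntries_matA

/-- The bounded operator `B` on `ℓ²`. -/
def opB : L2 →L[ℂ] L2 := tridiagOp F.matB F.isTridiagonal_matB F.hasBoundedEntries_matB

/-- The resolvent set `ρ(A, B)`: all `z ∈ ℂ` such that `z B - A` has a bounded inverse. -/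
def resolventSet : Set ℂ := {z | IsUnit (z • F.opB - F.opA)}

/-- The resolvent set as a subset of the extended plane: the point `∞` belongs to it if and only
if `B` has a bounded inverse. -/
def extendedResolventSet : Set (OnePoint ℂ) :=
  ((↑) : ℂ → OnePoint ℂ) '' F.resolventSet ∪ {w | w = OnePoint.infty ∧ IsUnit F.opB}

/-- The Weyl function `m(z) = ⟨(z B - A)⁻¹ e₀, e₀⟩` on `ρ(A, B)`. (In Mathlib the inner product is
linear in its second argument; `Ring.inverse` is the inverse of an invertible element.) -/
def m (z : ℂ) : ℂ :=
  inner ℂ (lp.single 2 0 1 : L2) (Ring.inverse (z • F.opB - F.opA) (lp.single 2 0 1 : L2))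

end MPFraction

/-- The root, in the extended plane, of a nonzero polynomial of degree at most one; it is `∞` if
the polynomial is constant. -/
def extendedRoot (p : ℂ[X]) : OnePoint ℂ :=
  if p.natDegree = 0 then OnePoint.infty else ((-p.coeff 0 / p.coeff 1 : ℂ) : OnePoint ℂ)

/-! ### Jordan curves and contour integrals -/

/-- `γ : [0, 1] → ℂ` is a parametrization of a rectifiable Jordan curve: closed, without further
self-intersections, and absolutely continuous (every rectifiable Jordan curve has such a
parametrization, for instance one proportional to arc length). -/
structure IsJordanParam (γ : ℝ → ℂ) : Prop where
  absolutelyContinuous : AbsolutelyContinuousOnInterval γ 0 1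
  closed : γ 0 = γ 1
  injOn : InjOn γ (Ico 0 1)

/-- The trace `Γ` of the curve `γ : [0, 1] → ℂ`. -/
def curveTrace (γ : ℝ → ℂ) : Set ℂ := γ '' Icc 0 1

/-- The contour integral `∫_γ f(ζ) dζ` along an absolutely continuous curve. -/
def contourIntegral (γ : ℝ → ℂ) (f : ℂ → ℂ) : ℂ := ∫ t in (0 : ℝ)..1, f (γ t) * deriv γ t

/-- The winding number of the closed curve `γ` about a point `w` not on the curve. -/
def windingNumber (γ : ℝ → ℂ) (w : ℂ) : ℂ :=
  (2 * Real.pi * Complex.I)⁻¹ * contourIntegral γ (fun ζ => (ζ - w)⁻¹)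

/-- The Jordan curve `γ`, being the boundary of the domain `G` of the extended plane, is oriented
such that `G` lies on its right: the winding number increases by one from `G` to the other side of
the curve. Thus it is `-1` in `G` and `0` on the other side if `G` is bounded, and it is `0` in `G`
and `1` on the other side if `∞ ∈ G`. -/
def HasOnRight (γ : ℝ → ℂ) (G : Set (OnePoint ℂ)) : Prop :=
  ∀ z w : ℂ, (z : OnePoint ℂ) ∈ G → (w : OnePoint ℂ) ∉ closure G →
    windingNumber γ w = windingNumber γ z + 1

/-- The functional `S(g) = (1 / 2πi) ∫_Γ g(ζ) m(ζ) dζ`. -/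
def MPFraction.functionalS (F : MPFraction) (γ : ℝ → ℂ) (g : ℂ → ℂ) : ℂ :=
  (2 * Real.pi * Complex.I)⁻¹ * contourIntegral γ (fun ζ => g ζ * F.m ζ)

end

/-! Let `r i j` be the entries of the inverse of the pencil, so that `m = r 0 0`, and let `P_n` be
the numerators of the convergents. By the column equations of the inverse, `q_n m - P_n` and `r n 0`
times `α_0ᴿ ⋯ α_{n-1}ᴿ` obey the same recurrence and agree (`IsTridiagInverse.continuant_mul`).
After division, the integrand of the first relation becomes `(r n 0 / ∏ αᴸ) p + P_n p / (∏ αᴸ ∏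
αᴿ)`, and each summand integrates to zero by Cauchy's theorem, on opposite sides of the curve.

The second summand is rational with all finite poles in `Γext`, hence holomorphic on the other side.
If `∞` lies on that other side, no root is `∞`, so the denominator has exact degree `2n` against at
most `2n - 2` in the numerator.

For the first summand the zeros of `∏ αᴸ` have to be cancelled by `r n 0`. The row equations make
the vector `(r n j)`, `j ≤ n`, proportional to `D_j = q_j α_jᴸ ⋯ α_{n-1}ᴸ`, whose entry at `j = 0`
is `∏ αᴸ` (`IsTridiagInverse.mul_tridiagDenom`). The `D_j` have no common zero in the resolvent set:
where `α_kᴸ` vanishes the pencil is block triangular, which forces `q_{k+1} ≠ 0`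
(`IsTridiagInverse.exists_tridiagDenom_ne_zero`). So the factor of proportionality is holomorphic on
the resolvent set (`IsPencilInverse.exists_quotient`). At `∞` the same argument, with `B` in place
of the pencil, gives the decay needed (`IsPencilInverse.tendsto_quotient`).

Cauchy's theorem is proved by Dixon's method (`IsClosedACCurve.cauchy_formula`) in a form suited to
the sphere: the winding numbers about the points outside the domain of holomorphy share a value `c`,
and `c ≠ 0` is allowed for functions with enough decay at `∞`. The second relation is the first one
for the transposed pencil. -/

noncomputable section

open Filter Topology

/-! ### Absolutely continuous complex valued functions -/

namespace AbsolutelyContinuousOnInterval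

lemma of_dist_le {X Y : Type*} [PseudoMetricSpace X] [PseudoMetricSpace Y] {f : ℝ → X} {g : ℝ → Y}
    {a b C : ℝ} (hf : AbsolutelyContinuousOnInterval f a b)
    (h : ∀ x ∈ uIcc a b, ∀ y ∈ uIcc a b, dist (g x) (g y) ≤ C * dist (f x) (f y)) :
    AbsolutelyContinuousOnInterval g a b := by
  have h0 := Tendsto.const_mul C hf
  rw [mul_zero] at h0
  refine squeeze_zero' (Eventually.of_forall fun E => Finset.sum_nonneg fun i _ => dist_nonneg)
    ?_ h0
  -- The principal part of the filter says that the intervals of `E` have their endpoints in `uIcc a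
  -- b`, where `h` applies.
  filter_upwards [mem_inf_of_right (mem_principal_self _)] with E hE
  rw [Finset.mul_sum]
  exact Finset.sum_le_sum fun i hi => h _ (hE.1 i hi).1 _ (hE.1 i hi).2

variable {f : ℝ → ℂ} {a b : ℝ}

lemma re (hf : AbsolutelyContinuousOnInterval f a b) :
    AbsolutelyContinuousOnInterval (fun t => (f t).re) a b :=
  hf.of_dist_le (C := 1) fun x _ y _ => by
    rw [one_mul, Real.dist_eq, dist_eq_norm, ← Complex.sub_re]
    exact Complex.abs_re_le_norm _

lemma im (hf : AbsolutelyContinuousOnInterval f a b) :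
    AbsolutelyContinuousOnInterval (fun t => (f t).im) a b :=
  hf.of_dist_le (C := 1) fun x _ y _ => by
    rw [one_mul, Real.dist_eq, dist_eq_norm, ← Complex.sub_im]
    exact Complex.abs_im_le_norm _

lemma ae_differentiableAt_complex (hf : AbsolutelyContinuousOnInterval f a b) :
    ∀ᵐ t, t ∈ uIcc a b → DifferentiableAt ℝ f t :=
  hf.boundedVariationOn.ae_differentiableAt_of_mem_uIcc

/-- Reduces integrability of the derivative and the fundamental theorem of calculus to the
real-valued case. -/
lemma ae_deriv_eq (hf : AbsolutelyContinuousOnInterval f a b) :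
    ∀ᵐ t, t ∈ uIoc a b → deriv f t =
      ((deriv (fun t => (f t).re) t : ℝ) : ℂ) + ((deriv (fun t => (f t).im) t : ℝ) : ℂ) * Complex.I := by
  filter_upwards [hf.ae_differentiableAt_complex] with t ht ht'
  have h := (ht (uIoc_subset_uIcc ht')).hasDerivAt
  have hre : HasDerivAt (fun t => (f t).re) (deriv f t).re t :=
    (Complex.reCLM.hasFDerivAt.comp_hasDerivAt t h)
  have him : HasDerivAt (fun t => (f t).im) (deriv f t).im t :=
    (Complex.imCLM.hasFDerivAt.comp_hasDerivAt t h)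
  rw [hre.deriv, him.deriv, Complex.re_add_im]

lemma intervalIntegrable_deriv_complex (hf : AbsolutelyContinuousOnInterval f a b) :
    IntervalIntegrable (deriv f) volume a b := by
  have h1 : IntervalIntegrable (fun t => ((deriv (fun t => (f t).re) t : ℝ) : ℂ)) volume a b :=
    ⟨hf.re.intervalIntegrable_deriv.1.ofReal, hf.re.intervalIntegrable_deriv.2.ofReal⟩
  have h2 : IntervalIntegrable (fun t => ((deriv (fun t => (f t).im) t : ℝ) : ℂ)) volume a b :=
    ⟨hf.im.intervalIntegrable_deriv.1.ofReal, hf.im.intervalIntegrable_deriv.2.ofReal⟩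
  refine (h1.add (h2.mul_const Complex.I)).congr_ae ?_
  rw [EventuallyEq, ae_restrict_iff' measurableSet_uIoc]
  filter_upwards [hf.ae_deriv_eq] with t ht ht'
  exact (ht ht').symm

lemma integral_deriv_complex (hf : AbsolutelyContinuousOnInterval f a b) :
    ∫ t in a..b, deriv f t = f b - f a := by
  have h1 : IntervalIntegrable (fun t => ((deriv (fun t => (f t).re) t : ℝ) : ℂ)) volume a b :=
    ⟨hf.re.intervalIntegrable_deriv.1.ofReal, hf.re.intervalIntegrable_deriv.2.ofReal⟩
  have h2 : IntervalIntegrable (fun t => ((deriv (fun t => (f t).im) t : ℝ) : ℂ)) volume a b :=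
    ⟨hf.im.intervalIntegrable_deriv.1.ofReal, hf.im.intervalIntegrable_deriv.2.ofReal⟩
  rw [intervalIntegral.integral_congr_ae hf.ae_deriv_eq,
    intervalIntegral.integral_add h1 (h2.mul_const _), intervalIntegral.integral_mul_const,
    intervalIntegral.integral_ofReal, intervalIntegral.integral_ofReal,
    hf.re.integral_deriv_eq_sub, hf.im.integral_deriv_eq_sub]
  apply Complex.ext <;> simp

end AbsolutelyContinuousOnInterval

/-! ### Integrals along absolutely continuous closed curves -/

/-- The curve `γ` on `[0, 1]` is closed and absolutely continuous. -/
structure IsClosedACCurve (γ : ℝ → ℂ) : Prop where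
  ac : AbsolutelyContinuousOnInterval γ 0 1
  closed : γ 0 = γ 1

lemma IsJordanParam.isClosedACCurve {γ : ℝ → ℂ} (h : IsJordanParam γ) : IsClosedACCurve γ :=
  ⟨h.absolutelyContinuous, h.closed⟩

namespace IsClosedACCurve

variable {γ : ℝ → ℂ}

lemma continuousOn (hγ : IsClosedACCurve γ) : ContinuousOn γ (Icc 0 1) := by
  simpa using hγ.ac.continuousOn

lemma isCompact_trace (hγ : IsClosedACCurve γ) : IsCompact (curveTrace γ) :=
  isCompact_Icc.image_of_continuousOn hγ.continuousOn

lemma _root_.mem_curveTrace {t : ℝ} (ht : t ∈ uIoc (0 : ℝ) 1) : γ t ∈ curveTrace γ :=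
  ⟨t, by simpa using uIoc_subset_uIcc ht, rfl⟩

lemma continuousOn_comp (hγ : IsClosedACCurve γ) {φ : ℂ → ℂ} (hφ : ContinuousOn φ (curveTrace γ)) :
    ContinuousOn (fun t => φ (γ t)) (Icc 0 1) :=
  hφ.comp hγ.continuousOn (mapsTo_image _ _)

lemma intervalIntegrable (hγ : IsClosedACCurve γ) {φ : ℂ → ℂ} (hφ : ContinuousOn φ (curveTrace γ)) :
    IntervalIntegrable (fun t => φ (γ t) * deriv γ t) volume 0 1 :=
  hγ.ac.intervalIntegrable_deriv_complex.continuousOn_mul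
    (by simpa using hγ.continuousOn_comp hφ)

lemma contourIntegral_add (hγ : IsClosedACCurve γ) {φ ψ : ℂ → ℂ} (hφ : ContinuousOn φ (curveTrace γ))
    (hψ : ContinuousOn ψ (curveTrace γ)) :
    contourIntegral γ (fun ζ => φ ζ + ψ ζ) = contourIntegral γ φ + contourIntegral γ ψ := by
  simp only [contourIntegral, add_mul]
  exact intervalIntegral.integral_add (hγ.intervalIntegrable hφ) (hγ.intervalIntegrable hψ)

lemma contourIntegral_const_mul (c : ℂ) (φ : ℂ → ℂ) :
    contourIntegral γ (fun ζ => c * φ ζ) = c * contourIntegral γ φ := by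
  simp only [contourIntegral, mul_assoc]
  exact intervalIntegral.integral_const_mul _ _

lemma contourIntegral_congr {φ ψ : ℂ → ℂ} (h : EqOn φ ψ (curveTrace γ)) :
    contourIntegral γ φ = contourIntegral γ ψ := by
  refine intervalIntegral.integral_congr fun t ht => ?_
  rw [h ⟨t, by simpa using ht, rfl⟩]

end IsClosedACCurve

/-! ### Differentiation under the integral sign; Cauchy integrals -/

/-- For holomorphic integrands a uniform bound on `G` suffices: Cauchy's estimate turns it into a
Lipschitz bound, and the derivative is measurable in `t` as a limit of difference quotients. -/
lemma hasDerivAt_integral_of_bounded {G : ℝ → ℂ → ℂ} {v : ℝ → ℂ} {z₀ : ℂ} {r C : ℝ} (hr : 0 < r)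
    (hv : IntervalIntegrable v volume 0 1)
    (hG : ∀ t ∈ Icc (0 : ℝ) 1, DifferentiableOn ℂ (G t) (Metric.ball z₀ r))
    (hC : ∀ t ∈ Icc (0 : ℝ) 1, ∀ z ∈ Metric.ball z₀ r, ‖G t z‖ ≤ C)
    (hc : ∀ z ∈ Metric.ball z₀ r, ContinuousOn (fun t => G t z) (Icc 0 1)) :
    HasDerivAt (fun z => ∫ t in (0 : ℝ)..1, G t z * v t)
      (∫ t in (0 : ℝ)..1, deriv (G t) z₀ * v t) z₀ := by
  have hint : ∀ z ∈ Metric.ball z₀ r, IntervalIntegrable (fun t => G t z * v t) volume 0 1 :=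
    fun z hz => hv.continuousOn_mul (by simpa using hc z hz)
  have hz₀ : z₀ ∈ Metric.ball z₀ r := Metric.mem_ball_self hr
  have hmem : ∀ {t : ℝ}, t ∈ uIoc (0 : ℝ) 1 → t ∈ Icc (0 : ℝ) 1 := fun ht => by
    simpa using uIoc_subset_uIcc ht
  have hderiv : ∀ t ∈ Icc (0 : ℝ) 1, HasDerivAt (G t) (deriv (G t) z₀) z₀ := fun t ht =>
    ((hG t ht).differentiableAt (Metric.isOpen_ball.mem_nhds hz₀)).hasDerivAt
  refine (intervalIntegral.hasDerivAt_integral_of_dominated_loc_of_lip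
    (F := fun z t => G t z * v t) (bound := fun t => C / (r / 4) * ‖v t‖)
    (Metric.ball_mem_nhds z₀ (half_pos hr)) ?_ (hint z₀ hz₀) ?_ ?_ (hv.norm.const_mul _) ?_).2
  · filter_upwards [Metric.ball_mem_nhds z₀ hr] with z hz
    exact (hint z hz).aestronglyMeasurable_restrict_uIoc
  -- The shift by `2` keeps `z₀ + h n` strictly inside the ball already for `n = 0`.
  · let h : ℕ → ℂ := fun n => ((r / (n + 2) : ℝ) : ℂ)
    have hpos : ∀ n : ℕ, 0 < r / ((n : ℝ) + 2) := fun n => by positivity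
    have hlim : Tendsto h atTop (𝓝[≠] 0) := by
      refine tendsto_nhdsWithin_iff.2 ⟨?_, Eventually.of_forall fun n => ?_⟩
      · have : Tendsto (fun n : ℕ => r / ((n : ℝ) + 2)) atTop (𝓝 0) :=
          tendsto_const_nhds.div_atTop
            (tendsto_atTop_add_const_right _ _ tendsto_natCast_atTop_atTop)
        simpa [h, Function.comp_def] using (Complex.continuous_ofReal.tendsto 0).comp this
      · simpa [h] using (Complex.ofReal_ne_zero.2 (hpos n).ne')
    have hball : ∀ n, z₀ + h n ∈ Metric.ball z₀ r := fun n => by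
      rw [Metric.mem_ball, dist_eq_norm, add_sub_cancel_left, Complex.norm_real,
        Real.norm_of_nonneg (hpos n).le, div_lt_iff₀ (by positivity)]
      nlinarith [Nat.cast_nonneg (α := ℝ) n]
    refine aestronglyMeasurable_of_tendsto_ae atTop
      (f := fun n t => (h n)⁻¹ • (G t (z₀ + h n) * v t - G t z₀ * v t)) (fun n => ?_) ?_
    · exact AEStronglyMeasurable.const_smul
        ((hint _ (hball n)).aestronglyMeasurable_restrict_uIoc.sub
          (hint _ hz₀).aestronglyMeasurable_restrict_uIoc) (h n)⁻¹
    · rw [ae_restrict_iff' measurableSet_uIoc]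
      refine Eventually.of_forall fun t ht => ?_
      have := (((hderiv t (hmem ht)).mul_const (v t)).tendsto_slope_zero).comp hlim
      exact this
  · refine Eventually.of_forall fun t ht => ?_
    refine LipschitzOnWith.of_dist_le_mul fun x hx y hy => ?_
    have hsub : Metric.ball z₀ (r / 2) ⊆ Metric.ball z₀ r :=
      Metric.ball_subset_ball (by linarith)
    have hC0 : 0 ≤ C := (norm_nonneg _).trans (hC t (hmem ht) z₀ hz₀)
    -- Cauchy's estimate on circles of radius `r / 4`, which stay in the ball since `r / 2 + r / 4 <
    -- r`.
    have hb : ∀ z ∈ Metric.ball z₀ (r / 2), ‖deriv (G t) z‖ ≤ C / (r / 4) := by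
      intro z hz
      have hcb : Metric.closedBall z (r / 4) ⊆ Metric.ball z₀ r := fun w hw => by
        rw [Metric.mem_closedBall] at hw
        rw [Metric.mem_ball] at hz ⊢
        linarith [dist_triangle w z z₀]
      refine Complex.norm_deriv_le_of_forall_mem_sphere_norm_le (by linarith)
        (((hG t (hmem ht)).mono hcb).diffContOnCl_ball subset_rfl) fun w hw =>
        hC t (hmem ht) w (hcb (Metric.sphere_subset_closedBall hw))
    have := (convex_ball z₀ (r / 2)).norm_image_sub_le_of_norm_deriv_le (𝕜 := ℂ)
      (fun z hz => (hG t (hmem ht)).differentiableAt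
        (Metric.isOpen_ball.mem_nhds (hsub hz))) hb hy hx
    rw [Real.coe_nnabs, abs_of_nonneg (by positivity), dist_eq_norm, dist_eq_norm, ← sub_mul,
      norm_mul]
    calc _ ≤ C / (r / 4) * ‖x - y‖ * ‖v t‖ := mul_le_mul_of_nonneg_right this (norm_nonneg _)
      _ = _ := by ring
  · exact Eventually.of_forall fun t ht => (hderiv t (hmem ht)).mul_const (v t)

namespace IsClosedACCurve

variable {γ : ℝ → ℂ}

lemma hasDerivAt_cauchyIntegral (hγ : IsClosedACCurve γ) {φ : ℂ → ℂ}
    (hφ : ContinuousOn φ (curveTrace γ)) {z₀ : ℂ} (hz₀ : z₀ ∉ curveTrace γ) :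
    HasDerivAt (fun z => contourIntegral γ fun ζ => φ ζ * (ζ - z)⁻¹)
      (contourIntegral γ fun ζ => φ ζ * ((ζ - z₀) ^ 2)⁻¹) z₀ := by
  obtain ⟨r, hr, hball⟩ := Metric.isOpen_iff.1 hγ.isCompact_trace.isClosed.isOpen_compl z₀ hz₀
  have hdist : ∀ ζ ∈ curveTrace γ, ∀ z ∈ Metric.ball z₀ (r / 2), r / 2 ≤ ‖ζ - z‖ := by
    intro ζ hζ z hz
    by_contra! h
    refine hball (a := ζ) ?_ hζ
    rw [← dist_eq_norm] at h
    rw [Metric.mem_ball] at hz ⊢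
    linarith [dist_triangle ζ z z₀]
  have hne : ∀ ζ ∈ curveTrace γ, ∀ z ∈ Metric.ball z₀ (r / 2), ζ - z ≠ 0 := fun ζ hζ z hz =>
    norm_pos_iff.1 ((half_pos hr).trans_le (hdist ζ hζ z hz))
  obtain ⟨K, hK⟩ := hγ.isCompact_trace.exists_bound_of_continuousOn hφ
  have hmem : ∀ t ∈ Icc (0 : ℝ) 1, γ t ∈ curveTrace γ := fun t ht => ⟨t, ht, rfl⟩
  have hder : ∀ t ∈ Icc (0 : ℝ) 1, ∀ z ∈ Metric.ball z₀ (r / 2),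
      HasDerivAt (fun z => φ (γ t) * (γ t - z)⁻¹) (φ (γ t) * ((γ t - z) ^ 2)⁻¹) z := by
    intro t ht z hz
    have := (((hasDerivAt_id z).const_sub (γ t)).inv (hne _ (hmem t ht) z hz)).const_mul (φ (γ t))
    refine this.congr_deriv ?_
    rw [neg_neg, one_div, id]
  have h := hasDerivAt_integral_of_bounded (G := fun t z => φ (γ t) * (γ t - z)⁻¹)
    (v := deriv γ) (z₀ := z₀) (C := K * (r / 2)⁻¹) (half_pos hr)
    hγ.ac.intervalIntegrable_deriv_complex
    (fun t ht z hz => (hder t ht z hz).differentiableAt.differentiableWithinAt)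
    (fun t ht z hz => by
      rw [norm_mul, norm_inv]
      exact mul_le_mul (hK _ (hmem t ht))
        (inv_anti₀ (half_pos hr) (hdist _ (hmem t ht) z hz)) (by positivity)
        ((norm_nonneg _).trans (hK _ (hmem t ht))))
    (fun z hz => hγ.continuousOn_comp (φ := fun ζ => φ ζ * (ζ - z)⁻¹)
      (hφ.mul ((continuousOn_id.sub continuousOn_const).inv₀ fun ζ hζ => hne ζ hζ z hz)))
  refine h.congr_deriv (intervalIntegral.integral_congr fun t ht => ?_)
  rw [(hder t (by simpa using ht) z₀ (Metric.mem_ball_self (half_pos hr))).deriv]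

lemma tendsto_cauchyIntegral (hγ : IsClosedACCurve γ) {φ : ℂ → ℂ}
    (hφ : ContinuousOn φ (curveTrace γ)) :
    Tendsto (fun z => contourIntegral γ fun ζ => φ ζ * (ζ - z)⁻¹) (cocompact ℂ) (𝓝 0) := by
  obtain ⟨K, hK⟩ := hγ.isCompact_trace.exists_bound_of_continuousOn hφ
  obtain ⟨R, hR⟩ := hγ.isCompact_trace.exists_bound_of_continuousOn continuousOn_id
  have hint := hγ.ac.intervalIntegrable_deriv_complex.norm
  have hlim : Tendsto (fun z : ℂ => K * (‖z‖ - R)⁻¹ * ∫ t in (0 : ℝ)..1, ‖deriv γ t‖)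
      (cocompact ℂ) (𝓝 0) := by
    have h1 : Tendsto (fun z : ℂ => (‖z‖ - R)⁻¹) (cocompact ℂ) (𝓝 0) :=
      tendsto_inv_atTop_zero.comp
        (tendsto_atTop_add_const_right _ (-R) (tendsto_norm_cocompact_atTop (E := ℂ)))
    simpa using (h1.const_mul K).mul_const (∫ t in (0 : ℝ)..1, ‖deriv γ t‖)
  refine squeeze_zero_norm' ?_ hlim
  filter_upwards [(tendsto_norm_cocompact_atTop (E := ℂ)).eventually (eventually_gt_atTop R)]
    with z hz
  rw [← intervalIntegral.integral_const_mul]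
  refine intervalIntegral.norm_integral_le_of_norm_le zero_le_one
    (Eventually.of_forall fun t ht => ?_) (hint.const_mul _)
  have hm : γ t ∈ curveTrace γ := ⟨t, Ioc_subset_Icc_self ht, rfl⟩
  rw [norm_mul, norm_mul, norm_inv]
  have h2 : ‖z‖ - R ≤ ‖γ t - z‖ := by
    have := hR _ hm
    simp only [id] at this
    have h3 := norm_sub_norm_le z (γ t)
    rw [norm_sub_rev] at h3
    linarith
  have hK0 : 0 ≤ K := (norm_nonneg _).trans (hK _ hm)
  gcongr ?_ * ?_ * _
  · exact hK _ hm
  · exact inv_anti₀ (by linarith) h2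

/-! ### The winding number -/

/-- The integrand has the primitive `-(ζ - w)⁻¹`. Inversion is Lipschitz away from `w`, so `(γ -
w)⁻¹` is again absolutely continuous and the fundamental theorem applies on the closed curve. -/
lemma contourIntegral_inv_sq (hγ : IsClosedACCurve γ) {w : ℂ} (hw : w ∉ curveTrace γ) :
    contourIntegral γ (fun ζ => ((ζ - w) ^ 2)⁻¹) = 0 := by
  obtain ⟨r, hr, hball⟩ := Metric.isOpen_iff.1 hγ.isCompact_trace.isClosed.isOpen_compl w hw
  have hmem : ∀ t ∈ uIcc (0 : ℝ) 1, γ t ∈ curveTrace γ := fun t ht =>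
    ⟨t, by simpa using ht, rfl⟩
  have hdist : ∀ ζ ∈ curveTrace γ, r ≤ ‖ζ - w‖ := fun ζ hζ => by
    by_contra! h
    exact hball (a := ζ) (by rwa [Metric.mem_ball, dist_eq_norm]) hζ
  have hne : ∀ ζ ∈ curveTrace γ, ζ - w ≠ 0 := fun ζ hζ =>
    norm_pos_iff.1 (hr.trans_le (hdist ζ hζ))
  have hac : AbsolutelyContinuousOnInterval (fun t => (γ t - w)⁻¹) 0 1 := by
    refine hγ.ac.of_dist_le (C := (r * r)⁻¹) fun x hx y hy => ?_
    have hx' := hmem x hx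
    have hy' := hmem y hy
    rw [dist_eq_norm, inv_sub_inv (hne _ hx') (hne _ hy'), norm_div, norm_mul,
      sub_sub_sub_cancel_right, dist_comm, dist_eq_norm, div_eq_inv_mul]
    gcongr
    · exact hdist _ hx'
    · exact hdist _ hy'
  have h0 := hac.integral_deriv_complex
  rw [hγ.closed, sub_self] at h0
  have h1 : ∫ t in (0 : ℝ)..1, deriv (fun t => (γ t - w)⁻¹) t =
      ∫ t in (0 : ℝ)..1, (-1) * (((γ t - w) ^ 2)⁻¹ * deriv γ t) := by
    refine intervalIntegral.integral_congr_ae ?_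
    filter_upwards [hγ.ac.ae_differentiableAt_complex] with t ht ht'
    have := ((ht (uIoc_subset_uIcc ht')).hasDerivAt.sub_const w).fun_inv
      (hne _ (mem_curveTrace ht'))
    rw [this.deriv, div_eq_inv_mul]
    ring
  rw [h1, intervalIntegral.integral_const_mul] at h0
  simpa [contourIntegral] using h0

lemma hasDerivAt_windingNumber (hγ : IsClosedACCurve γ) {w : ℂ} (hw : w ∉ curveTrace γ) :
    HasDerivAt (windingNumber γ) 0 w := by
  have h := hγ.hasDerivAt_cauchyIntegral (φ := fun _ => 1) continuousOn_const hw
  simp only [one_mul] at h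
  rw [hγ.contourIntegral_inv_sq hw] at h
  have h' := h.const_mul (2 * Real.pi * Complex.I)⁻¹
  rwa [mul_zero] at h'

lemma tendsto_windingNumber (hγ : IsClosedACCurve γ) :
    Tendsto (windingNumber γ) (cocompact ℂ) (𝓝 0) := by
  have h := (hγ.tendsto_cauchyIntegral (φ := fun _ => 1) continuousOn_const).const_mul
    (2 * Real.pi * Complex.I)⁻¹
  simp only [one_mul, mul_zero] at h
  exact h

/-- Local constancy, vanishing near `∞` and the jump prescribed by `HasOnRight` are all that is
needed of the winding number; its integrality plays no role. -/
lemma windingNumber_eventuallyEq (hγ : IsClosedACCurve γ) {w : ℂ} (hw : w ∉ curveTrace γ) :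
    ∀ᶠ z in 𝓝 w, windingNumber γ z = windingNumber γ w := by
  obtain ⟨r, hr, hball⟩ := Metric.isOpen_iff.1 hγ.isCompact_trace.isClosed.isOpen_compl w hw
  filter_upwards [Metric.ball_mem_nhds w hr] with z hz
  exact (convex_ball w r).is_const_of_fderivWithin_eq_zero (𝕜 := ℂ)
    (fun x hx => (hγ.hasDerivAt_windingNumber (hball hx)).differentiableAt.differentiableWithinAt)
    (fun x hx => by
      rw [fderivWithin_of_isOpen Metric.isOpen_ball hx]
      simpa using (hγ.hasDerivAt_windingNumber (hball hx)).hasFDerivAt.fderiv)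
    hz (Metric.mem_ball_self hr)

/-- Beyond a disc containing the curve, the winding number is constant along each ray from the
origin and tends to zero there. -/
lemma windingNumber_eventually_eq_zero (hγ : IsClosedACCurve γ) :
    ∀ᶠ z in cocompact ℂ, windingNumber γ z = 0 := by
  obtain ⟨R, hR⟩ := hγ.isCompact_trace.exists_bound_of_continuousOn continuousOn_id
  filter_upwards [(tendsto_norm_cocompact_atTop (E := ℂ)).eventually
    (eventually_gt_atTop (max R 0))] with z hz
  have hz0 : 0 < ‖z‖ := (le_max_right _ _).trans_lt hz
  have hout : ∀ s : ℝ, 1 ≤ s → (s : ℂ) * z ∉ curveTrace γ := fun s hs h => by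
    have := hR _ h
    simp only [id, norm_mul, Complex.norm_real, Real.norm_of_nonneg (zero_le_one.trans hs)] at this
    nlinarith [(le_max_left R 0).trans_lt hz]
  have hder : ∀ s : ℝ, 1 ≤ s → HasDerivAt (fun s : ℝ => windingNumber γ (s * z)) 0 s := by
    intro s hs
    have h1 : HasDerivAt (fun s : ℝ => (s : ℂ) * z) z s := by
      simpa using (Complex.ofRealCLM.hasDerivAt (x := s)).mul_const z
    have h2 := (hγ.hasDerivAt_windingNumber (hout s hs)).comp s h1
    rwa [zero_mul] at h2
  have hconst : ∀ s : ℝ, 1 ≤ s → windingNumber γ (s * z) = windingNumber γ z := by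
    intro s hs
    have := constant_of_has_deriv_right_zero (a := 1) (b := s)
      (f := fun s : ℝ => windingNumber γ (s * z))
      (fun x hx => (hder x hx.1).continuousAt.continuousWithinAt)
      (fun x hx => (hder x hx.1).hasDerivWithinAt) s ⟨hs, le_rfl⟩
    simpa using this
  have hray : Tendsto (fun s : ℝ => (s : ℂ) * z) atTop (cocompact ℂ) := by
    rw [← Metric.cobounded_eq_cocompact, ← tendsto_norm_atTop_iff_cobounded]
    simp only [norm_mul, Complex.norm_real]
    exact (tendsto_norm_atTop_atTop).atTop_mul_const hz0
  have hl := hγ.tendsto_windingNumber.comp hray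
  refine tendsto_nhds_unique (tendsto_const_nhds.congr' ?_) hl
  filter_upwards [eventually_ge_atTop 1] with s hs
  exact (hconst s hs).symm

end IsClosedACCurve

/-! ### The homological Cauchy formula -/

lemma dslope_comm (f : ℂ → ℂ) (a b : ℂ) : dslope f a b = dslope f b a := by
  rcases eq_or_ne a b with rfl | h
  · rfl
  · rw [dslope_of_ne f h.symm, dslope_of_ne f h, slope_comm]

namespace IsClosedACCurve

variable {γ : ℝ → ℂ} {U : Set ℂ} {f : ℂ → ℂ}

/-- The difference quotient is bounded uniformly in the curve point: by the mean value inequality if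
that point is in the disc of radius `R / 2`, and otherwise because it is at distance at least `R /
4` from `z`. -/
lemma differentiableAt_integral_dslope (hγ : IsClosedACCurve γ) (hU : IsOpen U)
    (hf : DifferentiableOn ℂ f U) (hΓ : curveTrace γ ⊆ U) {z₀ : ℂ} (hz₀ : z₀ ∈ U) :
    DifferentiableAt ℂ (fun z => contourIntegral γ fun ζ => dslope f ζ z) z₀ := by
  obtain ⟨R, hR, hball⟩ := Metric.isOpen_iff.1 hU z₀ hz₀
  have hcb : Metric.closedBall z₀ (R / 2) ⊆ U :=
    (Metric.closedBall_subset_ball (by linarith)).trans hball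
  obtain ⟨K, hK⟩ := hγ.isCompact_trace.exists_bound_of_continuousOn (hf.continuousOn.mono hΓ)
  obtain ⟨M, hM⟩ := (isCompact_closedBall z₀ (R / 2)).exists_bound_of_continuousOn
    (hf.continuousOn.mono hcb)
  obtain ⟨D, hD⟩ := (isCompact_closedBall z₀ (R / 2)).exists_bound_of_continuousOn
    ((hf.deriv hU).continuousOn.mono hcb)
  have hmem : ∀ t ∈ Icc (0 : ℝ) 1, γ t ∈ curveTrace γ := fun t ht => ⟨t, ht, rfl⟩
  have hsub : Metric.ball z₀ (R / 4) ⊆ Metric.closedBall z₀ (R / 2) :=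
    Metric.ball_subset_closedBall.trans (Metric.closedBall_subset_closedBall (by linarith))
  have hd : ∀ a ∈ U, DifferentiableAt ℂ f a := fun a ha => hf.differentiableAt (hU.mem_nhds ha)
  refine (hasDerivAt_integral_of_bounded (G := fun t z => dslope f (γ t) z) (v := deriv γ)
    (C := max D ((K + M) / (R / 4))) (r := R / 4) (by linarith)
    hγ.ac.intervalIntegrable_deriv_complex (fun t ht => ?_) (fun t ht z hz => ?_)
    (fun z hz => ?_)).differentiableAt
  · exact ((Complex.differentiableOn_dslope (hU.mem_nhds (hΓ (hmem t ht)))).2 hf).mono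
      (hsub.trans hcb)
  · by_cases hclose : γ t ∈ Metric.closedBall z₀ (R / 2)
    · refine le_max_of_le_left ?_
      rcases eq_or_ne z (γ t) with h | h
      · rw [h, dslope_same]
        exact hD _ hclose
      · have := (convex_closedBall z₀ (R / 2)).norm_image_sub_le_of_norm_deriv_le (𝕜 := ℂ)
          (fun x hx => hd x (hcb hx)) hD hclose (hsub hz)
        rw [dslope_of_ne f h, slope_def_module, norm_smul, norm_inv,
          inv_mul_le_iff₀ (norm_pos_iff.2 (sub_ne_zero.2 h)), mul_comm]
        exact this
    · refine le_max_of_le_right ?_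
      have hfar : R / 4 ≤ ‖z - γ t‖ := by
        rw [Metric.mem_closedBall, not_le] at hclose
        rw [Metric.mem_ball] at hz
        rw [← dist_eq_norm]
        linarith [dist_triangle (γ t) z z₀, dist_comm (γ t) z]
      have h : z ≠ γ t := fun h => by
        rw [h, sub_self, norm_zero] at hfar
        linarith
      rw [dslope_of_ne f h, slope_def_module, norm_smul, norm_inv, div_eq_inv_mul]
      have h1 : ‖f z - f (γ t)‖ ≤ K + M := by
        have := norm_sub_le (f z) (f (γ t))
        linarith [hK _ (hmem t ht), hM _ (hsub hz)]
      exact mul_le_mul (inv_anti₀ (by linarith) hfar) h1 (norm_nonneg _) (by positivity)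
  -- By symmetry, continuity in the base point becomes continuity in the argument.
  · simp_rw [dslope_comm f _ z]
    have hz' := hcb (hsub hz)
    exact hγ.continuousOn_comp (φ := dslope f z)
      (((continuousOn_dslope (hU.mem_nhds hz')).2 ⟨hf.continuousOn, hd z hz'⟩).mono hΓ)

lemma contourIntegral_dslope (hγ : IsClosedACCurve γ) (hf : ContinuousOn f (curveTrace γ))
    {z : ℂ} (hz : z ∉ curveTrace γ) :
    contourIntegral γ (fun ζ => dslope f ζ z) =
      contourIntegral γ (fun ζ => f ζ * (ζ - z)⁻¹) -
        2 * Real.pi * Complex.I * windingNumber γ z * f z := by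
  have hne : ∀ ζ ∈ curveTrace γ, ζ - z ≠ 0 := fun ζ hζ => sub_ne_zero.2 fun h => hz (h ▸ hζ)
  have hinv : ContinuousOn (fun ζ => (ζ - z)⁻¹) (curveTrace γ) :=
    (continuousOn_id.sub continuousOn_const).inv₀ hne
  have h1 : contourIntegral γ (fun ζ => dslope f ζ z) =
      contourIntegral γ (fun ζ => f ζ * (ζ - z)⁻¹ + (-f z) * (ζ - z)⁻¹) := by
    refine contourIntegral_congr fun ζ hζ => ?_
    have hζz : z ≠ ζ := fun h => hz (h ▸ hζ)
    rw [dslope_of_ne f hζz, slope_def_module, smul_eq_mul, ← neg_sub ζ z, inv_neg]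
    ring
  have hpi : (2 * Real.pi * Complex.I : ℂ) ≠ 0 := Complex.two_pi_I_ne_zero
  rw [h1, hγ.contourIntegral_add (φ := fun ζ => f ζ * (ζ - z)⁻¹)
      (ψ := fun ζ => -f z * (ζ - z)⁻¹) (hf.mul hinv) (continuousOn_const.mul hinv),
    contourIntegral_const_mul, windingNumber, mul_inv_cancel_left₀ hpi]
  ring

/-- The homological Cauchy formula for a curve having the same winding number `c` about all points
outside of the domain `U` of holomorphy; if `c ≠ 0`, then `U` contains a neighbourhood of `∞`, and
the function vanishes there. -/
theorem cauchy_formula (hγ : IsClosedACCurve γ) (hU : IsOpen U)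
    (hf : DifferentiableOn ℂ f U) (hΓ : curveTrace γ ⊆ U) {c : ℂ}
    (hc : ∀ w ∉ U, windingNumber γ w = c)
    (hinf : c = 0 ∨ (∀ᶠ z in cocompact ℂ, z ∈ U) ∧ Tendsto f (cocompact ℂ) (𝓝 0))
    {z : ℂ} (hz : z ∈ U) (hzΓ : z ∉ curveTrace γ) :
    contourIntegral γ (fun ζ => f ζ * (ζ - z)⁻¹) =
      2 * Real.pi * Complex.I * (windingNumber γ z - c) * f z := by
  classical
  have hfΓ : ContinuousOn f (curveTrace γ) := hf.continuousOn.mono hΓ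
  set I : ℂ → ℂ := fun z => contourIntegral γ (fun ζ => f ζ * (ζ - z)⁻¹) with hI
  -- Dixon's function, with the additional term `2πi c f`. On `U` off the curve it equals `I - 2πi
  -- (windingNumber - c) f`, which is `I` wherever the winding number is `c`, in particular near
  -- every point outside `U`. So the two branches glue to an entire function; it tends to zero at
  -- `∞`, and Liouville's theorem gives `h = 0`.
  let h : ℂ → ℂ := fun z => if z ∈ U then
    contourIntegral γ (fun ζ => dslope f ζ z) + 2 * Real.pi * Complex.I * c * f z else I z
  have hU' : ∀ z ∈ U, z ∉ curveTrace γ →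
      h z = I z - 2 * Real.pi * Complex.I * (windingNumber γ z - c) * f z := by
    intro z hz hzΓ
    simp only [h, if_pos hz, hI]
    rw [hγ.contourIntegral_dslope hfΓ hzΓ]
    ring
  have hV : ∀ z ∉ curveTrace γ, windingNumber γ z = c → h z = I z := by
    intro z hzΓ hw
    by_cases hz : z ∈ U
    · rw [hU' z hz hzΓ, hw]
      ring
    · simp only [h, if_neg hz]
  have hoff : IsOpen (curveTrace γ)ᶜ := hγ.isCompact_trace.isClosed.isOpen_compl
  have hdiff : Differentiable ℂ h := by
    intro z
    by_cases hz : z ∈ U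
    · refine DifferentiableAt.congr_of_eventuallyEq
        ((hγ.differentiableAt_integral_dslope hU hf hΓ hz).add
          ((hf.differentiableAt (hU.mem_nhds hz)).const_mul (2 * Real.pi * Complex.I * c))) ?_
      filter_upwards [hU.mem_nhds hz] with w hw
      simp [h, hw]
    · have hzΓ : z ∉ curveTrace γ := fun h => hz (hΓ h)
      refine DifferentiableAt.congr_of_eventuallyEq
        (hγ.hasDerivAt_cauchyIntegral hfΓ hzΓ).differentiableAt ?_
      filter_upwards [hγ.windingNumber_eventuallyEq hzΓ, hoff.mem_nhds hzΓ] with w hw hwΓ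
      exact hV w hwΓ (hw.trans (hc z hz))
  have hlim : Tendsto h (cocompact ℂ) (𝓝 0) := by
    have hIlim : Tendsto I (cocompact ℂ) (𝓝 0) := hγ.tendsto_cauchyIntegral hfΓ
    have hout := hγ.isCompact_trace.compl_mem_cocompact
    rcases hinf with rfl | ⟨hev, hf0⟩
    · refine hIlim.congr' ?_
      filter_upwards [hγ.windingNumber_eventually_eq_zero, hout] with w hw hwΓ
      exact (hV w hwΓ hw).symm
    · have := hIlim.add (hf0.const_mul (2 * Real.pi * Complex.I * c))
      rw [mul_zero, add_zero] at this
      refine this.congr' ?_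
      filter_upwards [hγ.windingNumber_eventually_eq_zero, hout, hev] with w hw hwΓ hwU
      rw [hU' w hwU hwΓ, hw]
      ring
  have h0 := hdiff.apply_eq_of_tendsto_cocompact z hlim
  rw [hU' z hz hzΓ, sub_eq_zero] at h0
  exact h0

/-- The homological Cauchy theorem, for functions that vanish to second order at `∞` if the winding
number about the points outside of their domain is not zero. -/
theorem contourIntegral_eq_zero (hγ : IsClosedACCurve γ) (hU : IsOpen U)
    (hf : DifferentiableOn ℂ f U) (hΓ : curveTrace γ ⊆ U) {c : ℂ}
    (hc : ∀ w ∉ U, windingNumber γ w = c)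
    (hinf : c = 0 ∨
      (∀ᶠ z in cocompact ℂ, z ∈ U) ∧ Tendsto (fun z => z * f z) (cocompact ℂ) (𝓝 0))
    (hne : ∃ z ∈ U, z ∉ curveTrace γ) :
    contourIntegral γ f = 0 := by
  obtain ⟨z, hz, hzΓ⟩ := hne
  -- The factor `ζ - z` cancels the Cauchy kernel on the curve and makes the right side vanish; it
  -- costs one order of decay at `∞`.
  have h := hγ.cauchy_formula (f := fun ζ => (ζ - z) * f ζ) hU
    ((differentiableOn_id.sub_const z).mul hf) hΓ hc ?_ hz hzΓ
  · rw [sub_self, zero_mul, mul_zero] at h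
    rw [← h]
    refine contourIntegral_congr fun ζ hζ => ?_
    have : ζ - z ≠ 0 := sub_ne_zero.2 fun h => hzΓ (h ▸ hζ)
    field_simp
  · refine hinf.imp_right fun ⟨h1, h2⟩ => ⟨h1, ?_⟩
    have hinv : Tendsto (fun ζ : ℂ => ζ⁻¹) (cocompact ℂ) (𝓝 0) :=
      Metric.cobounded_eq_cocompact (α := ℂ) ▸ Filter.tendsto_inv₀_cobounded
    have h3 := h2.mul ((hinv.const_mul z).const_sub 1)
    simp only [mul_zero, sub_zero, zero_mul] at h3
    refine h3.congr' ?_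
    filter_upwards [(isCompact_singleton (x := (0 : ℂ))).compl_mem_cocompact] with ζ hζ
    have : ζ ≠ 0 := hζ
    field_simp

end IsClosedACCurve

/-! ### Two-sided inverses of tridiagonal matrices -/

section Continuant

variable {R : Type*} [CommRing R]

/-- The continuants with `K₀ = 1`, `K₁ = β₀`, `K_{n+2} = β_{n+1} K_{n+1} - a_n b_n K_n`. -/
def tridiagContinuant (β a b : ℕ → R) : ℕ → R
  | 0 => 1
  | 1 => β 0
  | (n + 2) => β (n + 1) * tridiagContinuant β a b (n + 1) - a n * b n * tridiagContinuant β a b n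

lemma tridiagContinuant_swap (β a b : ℕ → R) (n : ℕ) :
    tridiagContinuant β a b n = tridiagContinuant β b a n := by
  induction n using Nat.twoStepInduction with
  | zero => rfl
  | one => rfl
  | more n h0 h1 => rw [tridiagContinuant, tridiagContinuant, h0, h1, mul_comm (a n)]

/-- The entry at `(i, j)` of the tridiagonal matrix with diagonal `β`, entries `-b i` at
`(i, i + 1)` and `-a j` at `(j + 1, j)`. -/
def tridiagEntry (β a b : ℕ → R) (i j : ℕ) : R :=
  (if i = j then β j else 0) - (if i + 1 = j then b i else 0) - (if i = j + 1 then a j else 0)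

/-- Expansion along the last row leaves two minors; the off-diagonal one, expanded along its last
column, leaves `-b n` times the section of order `n`. -/
lemma det_tridiag (β a b : ℕ → R) (n : ℕ) :
    (Matrix.of fun i j : Fin n => tridiagEntry β a b i j).det = tridiagContinuant β a b n := by
  induction n using Nat.twoStepInduction with
  | zero => simp [tridiagContinuant]
  | one => simp [tridiagContinuant, tridiagEntry]
  | more n h0 h1 =>
    have hne : n ≠ n + 1 + 1 := by omega
    rw [Matrix.det_succ_row _ (Fin.last (n + 1)), Fin.sum_univ_castSucc, Fin.sum_univ_castSucc,
      Finset.sum_eq_zero]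
    swap
    · intro x _
      have := x.2
      have h : tridiagEntry β a b (n + 1) x = 0 := by
        simp only [tridiagEntry]
        rw [if_neg (by omega), if_neg (by omega), if_neg (by omega)]
        ring
      simp [h]
    have hminor : (((Matrix.of fun i j : Fin (n + 2) => tridiagEntry β a b i j).submatrix
        (Fin.last (n + 1)).succAbove (Fin.last n).castSucc.succAbove)).det =
        -b n * tridiagContinuant β a b n := by
      rw [Matrix.det_succ_column _ (Fin.last n), Fin.sum_univ_castSucc, Finset.sum_eq_zero]
      swap
      · intro x _
        have := x.2
        have h : tridiagEntry β a b x (n + 1) = 0 := by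
          simp only [tridiagEntry]
          rw [if_neg (by omega), if_neg (by omega), if_neg (by omega)]
          ring
        simp [h]
      rw [← h0]
      have hsub : ((Matrix.of fun i j : Fin (n + 2) => tridiagEntry β a b i j).submatrix
          (Fin.last (n + 1)).succAbove (Fin.last n).castSucc.succAbove).submatrix
          (Fin.last n).succAbove (Fin.last n).succAbove =
          Matrix.of fun i j : Fin n => tridiagEntry β a b i j := by
        ext i j
        have : ((Fin.last n).castSucc.succAbove j.castSucc) = j.castSucc.castSucc := by
          rw [Fin.succAbove_of_castSucc_lt]
          simp [Fin.lt_def]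
        simp [this]
      rw [hsub]
      simp [tridiagEntry, ← two_mul, hne]
    have hsub : ((Matrix.of fun i j : Fin (n + 2) => tridiagEntry β a b i j).submatrix
          (Fin.last (n + 1)).succAbove (Fin.last (n + 1)).succAbove) =
          Matrix.of fun i j : Fin (n + 1) => tridiagEntry β a b i j := by
      ext i j
      simp
    rw [hminor, hsub, h1]
    have hs1 : (-1 : R) ^ (n + 1 + n) = -1 := by
      rw [show n + 1 + n = 2 * n + 1 by ring, pow_succ, pow_mul]; simp
    have hs2 : (-1 : R) ^ (n + 1 + (n + 1)) = 1 := by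
      rw [← two_mul, pow_mul]; simp
    simp [tridiagEntry, tridiagContinuant, hs1, hs2, hne.symm]
    ring

end Continuant

/-- The infinite matrix `r` is a two-sided inverse of the tridiagonal matrix with diagonal `β`,
entries `-b i` at `(i, i + 1)` and `-a i` at `(i + 1, i)`. -/
structure IsTridiagInverse (β a b : ℕ → ℂ) (r : ℕ → ℕ → ℂ) : Prop where
  left_zero : ∀ n, r n 0 * β 0 - r n 1 * a 0 = if n = 0 then 1 else 0
  left_succ : ∀ n j, r n (j + 1) * β (j + 1) - r n j * b j - r n (j + 2) * a (j + 1) =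
    if n = j + 1 then 1 else 0
  right_zero : ∀ n, r 0 n * β 0 - r 1 n * b 0 = if n = 0 then 1 else 0
  right_succ : ∀ n j, r (j + 1) n * β (j + 1) - r j n * a j - r (j + 2) n * b (j + 1) =
    if n = j + 1 then 1 else 0

namespace IsTridiagInverse

variable {β a b : ℕ → ℂ} {r : ℕ → ℕ → ℂ}

lemma transpose (h : IsTridiagInverse β a b r) : IsTridiagInverse β b a (fun i j => r j i) :=
  ⟨h.right_zero, h.right_succ, h.left_zero, h.left_succ⟩

/-- The only entry below the leading section of order `k + 1` in its columns is `-a k = 0`. The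
matrix is thus block triangular, and the same section of `r` is a left inverse of this section. -/
lemma continuant_ne_zero (h : IsTridiagInverse β a b r) {k : ℕ} (hk : a k = 0) :
    tridiagContinuant β a b (k + 1) ≠ 0 := by
  rw [← det_tridiag]
  refine Matrix.det_ne_zero_of_left_inverse (B := Matrix.of fun i j : Fin (k + 1) => r i j) ?_
  ext i j
  have hj := j.2
  rw [Matrix.mul_apply, Matrix.one_apply]
  simp only [Matrix.of_apply]
  rw [Fin.sum_univ_eq_sum_range (fun l => r i l * tridiagEntry β a b l j) (k + 1)]
  simp only [tridiagEntry, mul_sub, Finset.sum_sub_distrib, mul_ite, mul_zero]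
  have e3 : ∑ l ∈ Finset.range (k + 1), (if l = (j : ℕ) + 1 then r i l * a j else 0) =
      r i (j + 1) * a j := by
    rcases Nat.lt_or_ge ((j : ℕ) + 1) (k + 1) with h1 | h1
    · rw [Finset.sum_ite_eq' _ _ (fun l => r i l * a j), if_pos (Finset.mem_range.2 h1)]
    -- The one term that the truncation cuts off carries the factor `a k = 0`.
    · have : (j : ℕ) = k := by omega
      simp [this, hk]
  have e1 : ∑ l ∈ Finset.range (k + 1), (if l = (j : ℕ) then r i l * β j else 0) =
      r i j * β j := by
    rw [Finset.sum_ite_eq' _ _ (fun l => r i l * β j), if_pos (Finset.mem_range.2 hj)]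
  rw [e1, e3]
  rcases hjj : (j : ℕ) with _ | j'
  · have := h.left_zero i
    simp only [Nat.add_eq_zero_iff, one_ne_zero, and_false, if_false, Finset.sum_const_zero,
      sub_zero, zero_add]
    rw [this]
    simp only [Fin.ext_iff, hjj]
  · have e2 : ∑ l ∈ Finset.range (k + 1), (if l + 1 = j' + 1 then r i l * b l else 0) =
        r i j' * b j' := by
      simp only [add_left_inj]
      rw [Finset.sum_ite_eq' _ j' (fun l => r i l * b l), if_pos (Finset.mem_range.2 (by omega))]
    rw [e2, h.left_succ i j']
    simp only [Fin.ext_iff, hjj]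

/-- The rows of the inverse are proportional to the continuants up to the diagonal. -/
lemma mul_continuant (h : IsTridiagInverse β a b r) {n i : ℕ} :
    ∀ j, i ≤ j → j ≤ n → r n i * tridiagContinuant β a b j =
      r n j * tridiagContinuant β a b i * ∏ l ∈ Finset.Ico i j, a l := by
  have hstep : ∀ j, j < n → r n j * tridiagContinuant β a b (j + 1) =
      r n (j + 1) * tridiagContinuant β a b j * a j := by
    intro j
    induction j with
    | zero =>
      intro hj
      have := h.left_zero n
      rw [if_neg (by omega)] at this
      simp only [tridiagContinuant]
      linear_combination this
    | succ j ih =>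
      intro hj
      have h1 := h.left_succ n j
      rw [if_neg (by omega)] at h1
      have h2 := ih (by omega)
      rw [tridiagContinuant]
      linear_combination tridiagContinuant β a b (j + 1) * h1 + b j * h2
  -- Both sides obey the same three-term recurrence in `d`; it is homogeneous because only columns
  -- before the `n`-th enter. The factors `a l` are never divided out, so they may vanish.
  have key : ∀ d, i + d ≤ n → r n i * tridiagContinuant β a b (i + d) =
      r n (i + d) * tridiagContinuant β a b i * ∏ l ∈ Finset.Ico i (i + d), a l := by
    intro d
    induction d using Nat.twoStepInduction with
    | zero => intro _; simp
    | one =>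
      intro hd
      rw [Finset.prod_Ico_succ_top le_rfl, Finset.Ico_self, Finset.prod_empty, one_mul]
      exact hstep i hd
    | more d ih0 ih1 =>
      intro hd
      have h1 := h.left_succ n (i + d)
      rw [if_neg (by omega)] at h1
      have e0 := ih0 (by omega)
      have e1 := ih1 (by omega)
      rw [← add_assoc] at e1 ⊢
      rw [Finset.prod_Ico_succ_top (by omega)] at e1
      rw [show i + d + 2 = i + d + 1 + 1 from rfl, Finset.prod_Ico_succ_top (by omega),
        Finset.prod_Ico_succ_top (by omega), tridiagContinuant]
      linear_combination β (i + d + 1) * e1 - a (i + d) * b (i + d) * e0 +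
        tridiagContinuant β a b i * (∏ l ∈ Finset.Ico i (i + d), a l) * a (i + d) * h1
  intro j hij hjn
  obtain ⟨d, rfl⟩ := Nat.exists_eq_add_of_le hij
  exact key d hjn

end IsTridiagInverse

/-- The continuant of order `j` times `a_j ⋯ a_{n-1}`. -/
def tridiagDenom {R : Type*} [CommRing R] (β a b : ℕ → R) (n j : ℕ) : R :=
  tridiagContinuant β a b j * ∏ l ∈ Finset.Ico j n, a l

namespace IsTridiagInverse

variable {β a b : ℕ → ℂ} {r : ℕ → ℕ → ℂ}

/-- The index is one past the last vanishing `a l` with `l < n`, or `0` if there is none. -/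
lemma exists_tridiagDenom_ne_zero (h : IsTridiagInverse β a b r) (n : ℕ) :
    ∃ j ≤ n, tridiagDenom β a b n j ≠ 0 := by
  induction n with
  | zero => exact ⟨0, le_rfl, by simp [tridiagDenom, tridiagContinuant]⟩
  | succ n ih =>
    by_cases ha : a n = 0
    · exact ⟨n + 1, le_rfl, by simpa [tridiagDenom] using h.continuant_ne_zero ha⟩
    · obtain ⟨j, hj, hne⟩ := ih
      refine ⟨j, hj.trans (Nat.le_succ n), ?_⟩
      rw [tridiagDenom, Finset.prod_Ico_succ_top hj, ← mul_assoc]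
      exact mul_ne_zero hne ha

lemma mul_tridiagDenom (h : IsTridiagInverse β a b r) {n i j : ℕ} (hi : i ≤ n) (hj : j ≤ n) :
    r n i * tridiagDenom β a b n j = r n j * tridiagDenom β a b n i := by
  wlog hij : i ≤ j generalizing i j
  · exact (this hj hi (le_of_not_ge hij)).symm
  rw [tridiagDenom, tridiagDenom, ← Finset.prod_Ico_consecutive _ hij hj]
  linear_combination (∏ l ∈ Finset.Ico j n, a l) * h.mul_continuant j hij hj

end IsTridiagInverse

/-- The numerators of the convergents: `P₀ = 0`, `P₁ = 1`,
`P_{n+2} = β_{n+1} P_{n+1} - a_n b_n P_n`. -/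
def tridiagNumerator {R : Type*} [CommRing R] (β a b : ℕ → R) : ℕ → R
  | 0 => 0
  | 1 => 1
  | (n + 2) => β (n + 1) * tridiagNumerator β a b (n + 1) - a n * b n * tridiagNumerator β a b n

/-- The remainder in the approximation of the Weyl function by a convergent is an entry of the
inverse. -/
lemma IsTridiagInverse.continuant_mul {β a b : ℕ → ℂ} {r : ℕ → ℕ → ℂ}
    (h : IsTridiagInverse β a b r) (n : ℕ) :
    tridiagContinuant β a b n * r 0 0 =
      r n 0 * ∏ l ∈ Finset.range n, b l + tridiagNumerator β a b n := by
  induction n using Nat.twoStepInduction with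
  | zero => simp [tridiagContinuant, tridiagNumerator]
  | one =>
    have := h.right_zero 0
    rw [if_pos rfl] at this
    simp only [tridiagContinuant, tridiagNumerator, Finset.prod_range_one]
    linear_combination this
  | more n h0 h1 =>
    have h2 := h.right_succ 0 n
    rw [if_neg (by omega)] at h2
    rw [Finset.prod_range_succ] at h1
    rw [tridiagContinuant, tridiagNumerator, Finset.prod_range_succ, Finset.prod_range_succ]
    linear_combination β (n + 1) * h1 - a n * b n * h0 +
      (∏ l ∈ Finset.range n, b l) * b n * h2

/-! ### Continuants of polynomials of degree at most one -/

section Polynomial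

variable {β a b : ℕ → ℂ[X]}

lemma eval_tridiagContinuant (β a b : ℕ → ℂ[X]) (z : ℂ) (n : ℕ) :
    (tridiagContinuant β a b n).eval z = tridiagContinuant (fun k => (β k).eval z)
      (fun k => (a k).eval z) (fun k => (b k).eval z) n := by
  induction n using Nat.twoStepInduction with
  | zero => simp [tridiagContinuant]
  | one => simp [tridiagContinuant]
  | more n h0 h1 => simp [tridiagContinuant, h0, h1]

lemma eval_tridiagNumerator (β a b : ℕ → ℂ[X]) (z : ℂ) (n : ℕ) :
    (tridiagNumerator β a b n).eval z = tridiagNumerator (fun k => (β k).eval z)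
      (fun k => (a k).eval z) (fun k => (b k).eval z) n := by
  induction n using Nat.twoStepInduction with
  | zero => simp [tridiagNumerator]
  | one => simp [tridiagNumerator]
  | more n h0 h1 => simp [tridiagNumerator, h0, h1]

lemma eval_tridiagDenom (β a b : ℕ → ℂ[X]) (z : ℂ) (n j : ℕ) :
    (tridiagDenom β a b n j).eval z = tridiagDenom (fun k => (β k).eval z)
      (fun k => (a k).eval z) (fun k => (b k).eval z) n j := by
  simp [tridiagDenom, eval_tridiagContinuant, eval_prod]

lemma natDegree_prod_le_card {ι : Type*} (s : Finset ι) {f : ι → ℂ[X]}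
    (hf : ∀ i, (f i).natDegree ≤ 1) : (∏ i ∈ s, f i).natDegree ≤ s.card :=
  (natDegree_prod_le s f).trans ((Finset.sum_le_card_nsmul s _ 1 fun i _ => hf i).trans (by simp))

lemma coeff_prod_card {ι : Type*} (s : Finset ι) {f : ι → ℂ[X]}
    (hf : ∀ i, (f i).natDegree ≤ 1) :
    (∏ i ∈ s, f i).coeff s.card = ∏ i ∈ s, (f i).coeff 1 := by
  simpa using coeff_prod_of_natDegree_le s f 1 fun i _ => hf i

lemma natDegree_tridiagContinuant_le (hβ : ∀ n, (β n).natDegree ≤ 1)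
    (ha : ∀ n, (a n).natDegree ≤ 1) (hb : ∀ n, (b n).natDegree ≤ 1) (n : ℕ) :
    (tridiagContinuant β a b n).natDegree ≤ n := by
  induction n using Nat.twoStepInduction with
  | zero => simp [tridiagContinuant]
  | one => simpa [tridiagContinuant] using hβ 0
  | more n h0 h1 =>
    rw [tridiagContinuant]
    refine (natDegree_sub_le _ _).trans (max_le ?_ ?_)
    · exact (natDegree_mul_le_of_le (hβ _) h1).trans (by omega)
    · exact (natDegree_mul_le_of_le (natDegree_mul_le_of_le (ha _) (hb _)) h0).trans (by omega)

lemma natDegree_tridiagNumerator_le (hβ : ∀ n, (β n).natDegree ≤ 1)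
    (ha : ∀ n, (a n).natDegree ≤ 1) (hb : ∀ n, (b n).natDegree ≤ 1) (n : ℕ) :
    (tridiagNumerator β a b n).natDegree ≤ n - 1 := by
  induction n using Nat.twoStepInduction with
  | zero => simp [tridiagNumerator]
  | one => simp [tridiagNumerator]
  | more n h0 h1 =>
    rw [tridiagNumerator]
    refine (natDegree_sub_le _ _).trans (max_le ?_ ?_)
    · exact (natDegree_mul_le_of_le (hβ _) h1).trans (by omega)
    · rcases n with _ | n
      · simp [tridiagNumerator]
      · exact (natDegree_mul_le_of_le (natDegree_mul_le_of_le (ha _) (hb _)) h0).trans (by omega)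

/-- The coefficient at the formal degree `n`, possibly zero, serves as the value at `∞`: it is the
continuant of `B`. This lets `∞` be treated like a finite point. -/
lemma coeff_tridiagContinuant (hβ : ∀ n, (β n).natDegree ≤ 1)
    (ha : ∀ n, (a n).natDegree ≤ 1) (hb : ∀ n, (b n).natDegree ≤ 1) (n : ℕ) :
    (tridiagContinuant β a b n).coeff n = tridiagContinuant (fun k => (β k).coeff 1)
      (fun k => (a k).coeff 1) (fun k => (b k).coeff 1) n := by
  induction n using Nat.twoStepInduction with
  | zero => simp [tridiagContinuant]
  | one => simp [tridiagContinuant]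
  | more n h0 h1 =>
    have hK := natDegree_tridiagContinuant_le hβ ha hb
    rw [tridiagContinuant, tridiagContinuant, coeff_sub, show n + 2 = 1 + (n + 1) by ring,
      coeff_mul_add_eq_of_natDegree_le (hβ _) (hK _), show 1 + (n + 1) = (1 + 1) + n by ring,
      coeff_mul_add_eq_of_natDegree_le (natDegree_mul_le_of_le (ha _) (hb _)) (hK _),
      coeff_mul_add_eq_of_natDegree_le (ha _) (hb _), h0, h1]

lemma natDegree_tridiagDenom_le (hβ : ∀ n, (β n).natDegree ≤ 1)
    (ha : ∀ n, (a n).natDegree ≤ 1) (hb : ∀ n, (b n).natDegree ≤ 1) {n j : ℕ} (hj : j ≤ n) :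
    (tridiagDenom β a b n j).natDegree ≤ n := by
  refine (natDegree_mul_le_of_le (natDegree_tridiagContinuant_le hβ ha hb j)
    (natDegree_prod_le_card _ ha)).trans ?_
  rw [Nat.card_Ico]
  omega

lemma coeff_tridiagDenom (hβ : ∀ n, (β n).natDegree ≤ 1)
    (ha : ∀ n, (a n).natDegree ≤ 1) (hb : ∀ n, (b n).natDegree ≤ 1) {n j : ℕ} (hj : j ≤ n) :
    (tridiagDenom β a b n j).coeff n = tridiagDenom (fun k => (β k).coeff 1)
      (fun k => (a k).coeff 1) (fun k => (b k).coeff 1) n j := by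
  have hn : n = j + (Finset.Ico j n).card := by rw [Nat.card_Ico]; omega
  rw [tridiagDenom, tridiagDenom, ← coeff_tridiagContinuant hβ ha hb, ← coeff_prod_card _ ha,
    ← coeff_mul_add_eq_of_natDegree_le (natDegree_tridiagContinuant_le hβ ha hb j)
      (natDegree_prod_le_card _ ha), ← hn]

lemma tendsto_eval_div_pow {p : ℂ[X]} {n : ℕ} (hp : p.natDegree ≤ n) :
    Tendsto (fun z => p.eval z / z ^ n) (cocompact ℂ) (𝓝 (p.coeff n)) := by
  have hinv : Tendsto (fun ζ : ℂ => ζ⁻¹) (cocompact ℂ) (𝓝 0) :=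
    Metric.cobounded_eq_cocompact (α := ℂ) ▸ Filter.tendsto_inv₀_cobounded
  have h1 : Tendsto (fun z : ℂ => ∑ i ∈ Finset.range (n + 1), p.coeff i * z⁻¹ ^ (n - i))
      (cocompact ℂ) (𝓝 (∑ i ∈ Finset.range (n + 1), p.coeff i * 0 ^ (n - i))) :=
    tendsto_finsetSum _ fun i _ => (hinv.pow _).const_mul _
  rw [Finset.sum_range_succ, Finset.sum_eq_zero fun i hi => ?_, zero_add, Nat.sub_self, pow_zero,
    mul_one] at h1
  swap
  · have := Finset.mem_range.1 hi
    rw [zero_pow (by omega), mul_zero]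
  refine h1.congr' ?_
  filter_upwards [(isCompact_singleton (x := (0 : ℂ))).compl_mem_cocompact] with z hz
  have hz0 : z ≠ 0 := hz
  rw [eval_eq_sum_range' (Nat.lt_succ_of_le hp), Finset.sum_div]
  refine Finset.sum_congr rfl fun i hi => ?_
  have hi' : i ≤ n := Nat.lt_succ_iff.1 (Finset.mem_range.1 hi)
  rw [inv_pow, ← pow_sub_mul_pow z hi']
  field_simp

end Polynomial

/-! ### The resolvent of the pencil -/

namespace MPPencil

/-- The standard unit vectors of `ℓ²`. -/
def unitVec (j : ℕ) : L2 := lp.single 2 j 1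

lemma unitVec_apply (j i : ℕ) : unitVec j i = if i = j then 1 else 0 := by
  simp [unitVec, Pi.single_apply]

/-- The operator `T` acts on the sequences of `ℓ²` as the tridiagonal matrix with diagonal `β`,
entries `-b i` at `(i, i + 1)` and `-a i` at `(i + 1, i)`. -/
structure ActsTridiagonally (T : L2 →L[ℂ] L2) (β a b : ℕ → ℂ) : Prop where
  zero : ∀ x, T x 0 = β 0 * x 0 - b 0 * x 1
  succ : ∀ x i, T x (i + 1) = β (i + 1) * x (i + 1) - a i * x i - b (i + 1) * x (i + 2)

namespace ActsTridiagonally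

variable {T : L2 →L[ℂ] L2} {β a b : ℕ → ℂ}

lemma apply_unitVec_zero (h : ActsTridiagonally T β a b) :
    T (unitVec 0) = β 0 • unitVec 0 - a 0 • unitVec 1 := by
  ext i
  rcases i with _ | i
  · simp only [h.zero, unitVec_apply, lp.coeFn_sub, lp.coeFn_smul, Pi.sub_apply, Pi.smul_apply,
      smul_eq_mul]
    grind
  · simp only [h.succ, unitVec_apply, lp.coeFn_sub, lp.coeFn_smul, Pi.sub_apply, Pi.smul_apply,
      smul_eq_mul]
    grind

lemma apply_unitVec_succ (h : ActsTridiagonally T β a b) (j : ℕ) :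
    T (unitVec (j + 1)) =
      β (j + 1) • unitVec (j + 1) - b j • unitVec j - a (j + 1) • unitVec (j + 2) := by
  ext i
  rcases i with _ | i
  · simp only [h.zero, unitVec_apply, lp.coeFn_sub, lp.coeFn_smul, Pi.sub_apply, Pi.smul_apply,
      smul_eq_mul]
    grind
  · simp only [h.succ, unitVec_apply, lp.coeFn_sub, lp.coeFn_smul, Pi.sub_apply, Pi.smul_apply,
      smul_eq_mul]
    grind

/-- `T` maps unit vectors to finite combinations of unit vectors, and each coordinate of `T x`
involves at most three of `x`; so both operator identities become finite sums. -/
lemma isTridiagInverse (h : ActsTridiagonally T β a b) {S : L2 →L[ℂ] L2} (hST : S * T = 1)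
    (hTS : T * S = 1) : IsTridiagInverse β a b (fun i j => S (unitVec j) i) := by
  have h1 : ∀ j, S (T (unitVec j)) = unitVec j := fun j => by
    rw [← mul_apply_eq_comp, hST, one_apply_eq_self]
  have h2 : ∀ j, T (S (unitVec j)) = unitVec j := fun j => by
    rw [← mul_apply_eq_comp, hTS, one_apply_eq_self]
  refine ⟨fun n => ?_, fun n j => ?_, fun n => ?_, fun n j => ?_⟩
  · have := congrArg (fun x : L2 => x n) (h1 0)
    simp only [h.apply_unitVec_zero, map_sub, map_smul, lp.coeFn_sub, lp.coeFn_smul, Pi.sub_apply,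
      Pi.smul_apply, smul_eq_mul, unitVec_apply 0] at this
    rw [← this]
    ring
  · have := congrArg (fun x : L2 => x n) (h1 (j + 1))
    simp only [h.apply_unitVec_succ, map_sub, map_smul, lp.coeFn_sub, lp.coeFn_smul, Pi.sub_apply,
      Pi.smul_apply, smul_eq_mul, unitVec_apply (j + 1) n] at this
    rw [← this]
    ring
  · have := congrArg (fun x : L2 => x 0) (h2 n)
    simp only [h.zero, unitVec_apply n 0] at this
    rw [show (if n = 0 then (1 : ℂ) else 0) = if 0 = n then 1 else 0 by simp only [eq_comm],
      ← this]
    ring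
  · have := congrArg (fun x : L2 => x (j + 1)) (h2 n)
    simp only [h.succ, unitVec_apply n (j + 1)] at this
    rw [show (if n = j + 1 then (1 : ℂ) else 0) = if j + 1 = n then 1 else 0 by
      simp only [eq_comm], ← this]
    ring

end ActsTridiagonally

lemma tridiagOp_apply_zero (M : Matrix ℕ ℕ ℂ) (hM : IsTridiagonal M) (hb : HasBoundedEntries M)
    (x : L2) : tridiagOp M hM hb x 0 = M 0 0 * x 0 + M 0 1 * x 1 := by
  change mulVec M x 0 = _
  rw [mulVec_eq_sum hM]
  exact Finset.sum_pair (zero_ne_one (α := ℕ))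

lemma tridiagOp_apply_succ (M : Matrix ℕ ℕ ℂ) (hM : IsTridiagonal M) (hb : HasBoundedEntries M)
    (x : L2) (i : ℕ) : tridiagOp M hM hb x (i + 1) =
      M (i + 1) i * x i + M (i + 1) (i + 1) * x (i + 1) + M (i + 1) (i + 2) * x (i + 2) := by
  change mulVec M x (i + 1) = _
  rw [mulVec_eq_sum hM, show Finset.Icc (i + 1 - 1) (i + 1 + 1) = {i, i + 1, i + 2} by
    ext j
    simp only [Finset.mem_Icc, Finset.mem_insert, Finset.mem_singleton]
    omega, Finset.sum_insert (by simp), Finset.sum_pair (by omega), add_assoc]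

end MPPencil

namespace MPFraction

open MPPencil

variable (F : MPFraction)

lemma q_eq_tridiagContinuant (n : ℕ) : F.q n = tridiagContinuant F.β F.αL F.αR n := by
  induction n using Nat.twoStepInduction with
  | zero => rfl
  | one => rfl
  | more n h0 h1 => rw [q, tridiagContinuant, h0, h1]

lemma entry_self (i : ℕ) : F.entry i i = F.β i := by simp [entry]

lemma entry_succ_right (i : ℕ) : F.entry i (i + 1) = -F.αR i := by simp [entry]

lemma entry_succ_left (i : ℕ) : F.entry (i + 1) i = -F.αL i := by
  rw [entry, if_neg (by omega), if_neg (by omega), if_pos rfl]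

lemma actsTridiagonally_opB : ActsTridiagonally F.opB (fun n => (F.β n).coeff 1)
    (fun n => (F.αL n).coeff 1) (fun n => (F.αR n).coeff 1) where
  zero x := by
    rw [opB, tridiagOp_apply_zero]
    simp only [matB, entry_self, F.entry_succ_right 0, coeff_neg]
    ring
  succ x i := by
    rw [opB, tridiagOp_apply_succ]
    simp only [matB, entry_self, entry_succ_left, F.entry_succ_right (i + 1), coeff_neg]
    ring

lemma actsTridiagonally_pencil (z : ℂ) : ActsTridiagonally (z • F.opB - F.opA)
    (fun n => (F.β n).eval z) (fun n => (F.αL n).eval z) (fun n => (F.αR n).eval z) where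
  zero x := by
    have h1 := F.eval_entry 0 0 z
    have h2 := F.eval_entry 0 1 z
    rw [F.entry_self] at h1
    rw [F.entry_succ_right 0, eval_neg] at h2
    change z * F.opB x 0 - F.opA x 0 = _
    rw [opB, opA, tridiagOp_apply_zero, tridiagOp_apply_zero]
    linear_combination -(x 0) * h1 - x 1 * h2
  succ x i := by
    have h1 := F.eval_entry (i + 1) (i + 1) z
    have h2 := F.eval_entry (i + 1) (i + 2) z
    have h3 := F.eval_entry (i + 1) i z
    rw [F.entry_self] at h1
    rw [F.entry_succ_right (i + 1), eval_neg] at h2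
    rw [F.entry_succ_left, eval_neg] at h3
    change z * F.opB x (i + 1) - F.opA x (i + 1) = _
    rw [opB, opA, tridiagOp_apply_succ, tridiagOp_apply_succ]
    linear_combination -(x (i + 1)) * h1 - x (i + 2) * h2 - x i * h3

/-- The entries of the inverse of the pencil. -/
def resolventEntry (i j : ℕ) (z : ℂ) : ℂ := Ring.inverse (z • F.opB - F.opA) (unitVec j) i

/-- The entries of the inverse of `B`. -/
def invBEntry (i j : ℕ) : ℂ := Ring.inverse F.opB (unitVec j) i

lemma m_eq (z : ℂ) : F.m z = F.resolventEntry 0 0 z := by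
  rw [m, resolventEntry, unitVec, lp.inner_single_left]
  simp

lemma isTridiagInverse_resolventEntry {z : ℂ} (hz : z ∈ F.resolventSet) :
    IsTridiagInverse (fun n => (F.β n).eval z) (fun n => (F.αL n).eval z)
      (fun n => (F.αR n).eval z) (fun i j => F.resolventEntry i j z) :=
  (F.actsTridiagonally_pencil z).isTridiagInverse (Ring.inverse_mul_cancel _ hz)
    (Ring.mul_inverse_cancel _ hz)

lemma isTridiagInverse_invBEntry (hB : IsUnit F.opB) :
    IsTridiagInverse (fun n => (F.β n).coeff 1) (fun n => (F.αL n).coeff 1)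
      (fun n => (F.αR n).coeff 1) F.invBEntry :=
  F.actsTridiagonally_opB.isTridiagInverse (Ring.inverse_mul_cancel _ hB)
    (Ring.mul_inverse_cancel _ hB)

/-- The evaluation of the `(i, j)` entry of an operator. -/
def entryCLM (i j : ℕ) : (L2 →L[ℂ] L2) →L[ℂ] ℂ :=
  (innerSL ℂ (unitVec i)).comp (ContinuousLinearMap.apply ℂ L2 (unitVec j))

lemma entryCLM_apply (i j : ℕ) (T : L2 →L[ℂ] L2) : entryCLM i j T = T (unitVec j) i := by
  change inner ℂ (unitVec i) (T (unitVec j)) = _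
  rw [unitVec, lp.inner_single_left]
  simp

lemma isOpen_resolventSet : IsOpen F.resolventSet :=
  Units.isOpen.preimage (by fun_prop : Continuous fun z : ℂ => z • F.opB - F.opA)

lemma differentiableOn_resolventEntry (i j : ℕ) :
    DifferentiableOn ℂ (F.resolventEntry i j) F.resolventSet := by
  intro z hz
  obtain ⟨u, hu⟩ : IsUnit (z • F.opB - F.opA) := hz
  have h1 : DifferentiableAt ℂ (fun z : ℂ => z • F.opB - F.opA) z := by fun_prop
  have h2 : DifferentiableAt ℂ Ring.inverse (z • F.opB - F.opA) := by
    rw [← hu]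
    exact differentiableAt_inverse u.isUnit
  have h3 := ((entryCLM i j).differentiableAt).comp z (h2.comp z h1)
  refine DifferentiableAt.differentiableWithinAt (h3.congr_of_eventuallyEq ?_)
  exact Eventually.of_forall fun w => (entryCLM_apply i j _).symm

/-- `z (z B - A)⁻¹ = (B - z⁻¹ A)⁻¹`, the units are open, and inversion is continuous on them. -/
lemma tendsto_smul_inverse (hB : IsUnit F.opB) :
    (∀ᶠ z in cocompact ℂ, z ∈ F.resolventSet) ∧
      Tendsto (fun z : ℂ => z • Ring.inverse (z • F.opB - F.opA)) (cocompact ℂ)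
        (𝓝 (Ring.inverse F.opB)) := by
  have hinv : Tendsto (fun ζ : ℂ => ζ⁻¹) (cocompact ℂ) (𝓝 0) :=
    Metric.cobounded_eq_cocompact (α := ℂ) ▸ Filter.tendsto_inv₀_cobounded
  have h1 : Tendsto (fun z : ℂ => F.opB - z⁻¹ • F.opA) (cocompact ℂ) (𝓝 F.opB) := by
    simpa using (hinv.smul_const F.opA).const_sub F.opB
  have hne : ∀ᶠ z : ℂ in cocompact ℂ, z ≠ 0 :=
    (isCompact_singleton (x := (0 : ℂ))).compl_mem_cocompact
  have hunit := h1.eventually (Units.isOpen.mem_nhds hB)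
  have heq : ∀ z : ℂ, z ≠ 0 → z • F.opB - F.opA = z • (F.opB - z⁻¹ • F.opA) := fun z hz => by
    rw [smul_sub, smul_inv_smul₀ hz]
  refine ⟨?_, ?_⟩
  · filter_upwards [hne, hunit] with z hz hu
    change IsUnit (z • F.opB - F.opA)
    rw [heq z hz]
    exact IsUnit.smul (Units.mk0 z hz) (show IsUnit (F.opB - z⁻¹ • F.opA) from hu)
  · obtain ⟨u, hu⟩ := hB
    have h2 : Tendsto Ring.inverse (𝓝 F.opB) (𝓝 (Ring.inverse F.opB)) := by
      rw [← hu]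
      exact NormedRing.inverse_continuousAt u
    refine (h2.comp h1).congr' ?_
    filter_upwards [hne, hunit] with z hz hu
    rw [heq z hz]
    have hu' : IsUnit (F.opB - z⁻¹ • F.opA) := hu
    change Ring.inverse (F.opB - z⁻¹ • F.opA) = _
    have h3 : IsUnit (z • (F.opB - z⁻¹ • F.opA)) := IsUnit.smul (Units.mk0 z hz) hu'
    refine hu'.mul_left_cancel ?_
    rw [Ring.mul_inverse_cancel _ hu', mul_smul_comm, ← smul_mul_assoc, Ring.mul_inverse_cancel _ h3]

lemma tendsto_mul_resolventEntry (hB : IsUnit F.opB) (i j : ℕ) :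
    Tendsto (fun z => z * F.resolventEntry i j z) (cocompact ℂ) (𝓝 (F.invBEntry i j)) := by
  have := ((entryCLM i j).continuous.tendsto _).comp (F.tendsto_smul_inverse hB).2
  rw [entryCLM_apply] at this
  refine this.congr fun z => ?_
  simp [entryCLM_apply, resolventEntry]

end MPFraction

/-! ### Domains of the extended plane bounded by a curve -/

/-- The domain `G` of the extended plane is bounded by the closed absolutely continuous curve `γ`,
and lies on its right. -/
structure LiesRightOf (G : Set (OnePoint ℂ)) (γ : ℝ → ℂ) : Prop where
  curve : IsClosedACCurve γ
  isOpen : IsOpen G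
  isConnected : IsConnected G
  frontier_eq : frontier G = ((↑) : ℂ → OnePoint ℂ) '' curveTrace γ
  right : HasOnRight γ G

namespace LiesRightOf

variable {G : Set (OnePoint ℂ)} {γ : ℝ → ℂ}

lemma exists_coe_mem (h : LiesRightOf G γ) : ∃ z : ℂ, (z : OnePoint ℂ) ∈ G := by
  obtain ⟨_, hx, z, rfl⟩ := OnePoint.denseRange_coe.inter_open_nonempty G h.isOpen
    h.isConnected.nonempty
  exact ⟨z, hx⟩

lemma notMem_trace (h : LiesRightOf G γ) {z : ℂ} (hz : (z : OnePoint ℂ) ∈ G) :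
    z ∉ curveTrace γ := fun hzΓ => by
  have h1 : (z : OnePoint ℂ) ∈ frontier G := h.frontier_eq ▸ mem_image_of_mem _ hzΓ
  rw [h.isOpen.frontier_eq] at h1
  exact h1.2 hz

lemma trace_subset_closure (h : LiesRightOf G γ) {z : ℂ} (hz : z ∈ curveTrace γ) :
    (z : OnePoint ℂ) ∈ closure G :=
  frontier_subset_closure (h.frontier_eq ▸ mem_image_of_mem _ hz)

/-- The boundary consists of finite points, so `∞` is either in `G` or exterior to it. -/
lemma eventually_notMem_closure (h : LiesRightOf G γ) (hinf : OnePoint.infty ∉ G) :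
    ∀ᶠ z : ℂ in cocompact ℂ, (z : OnePoint ℂ) ∉ closure G := by
  have h1 : (OnePoint.infty : OnePoint ℂ) ∉ closure G := fun hcl => by
    have h2 : (OnePoint.infty : OnePoint ℂ) ∈ frontier G := by
      rw [h.isOpen.frontier_eq]
      exact ⟨hcl, hinf⟩
    rw [h.frontier_eq] at h2
    obtain ⟨z, -, hz⟩ := h2
    exact OnePoint.coe_ne_infty z hz
  rw [← coclosedCompact_eq_cocompact]
  exact OnePoint.tendsto_coe_infty.eventually (isClosed_closure.isOpen_compl.mem_nhds h1)

/-- The winding number is constant in the domain, and vanishes there if `∞` belongs to it. -/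
lemma exists_windingNumber_eq (h : LiesRightOf G γ) :
    ∃ c : ℂ, (∀ z : ℂ, (z : OnePoint ℂ) ∈ G → windingNumber γ z = c) ∧
      (OnePoint.infty ∈ G → c = 0) := by
  -- The value `0` at `∞` makes the winding number locally constant on `G` also at that point.
  let w : OnePoint ℂ → ℂ := fun x => OnePoint.elim x 0 (windingNumber γ)
  have hloc : ∀ x ∈ G, ∀ᶠ y in 𝓝 x, w y = w x := by
    intro x hx
    induction x using OnePoint.rec with
    | infty =>
      rw [OnePoint.nhds_infty_eq, eventually_sup, eventually_map, coclosedCompact_eq_cocompact]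
      exact ⟨h.curve.windingNumber_eventually_eq_zero, by simp⟩
    | coe z =>
      rw [OnePoint.nhds_coe_eq, eventually_map]
      exact h.curve.windingNumber_eventuallyEq (h.notMem_trace hx)
  obtain ⟨x₀, hx₀⟩ := h.isConnected.nonempty
  have hmem : ∀ {s : Set (OnePoint ℂ)} {x}, x ∈ interior s → x ∈ s := fun h => interior_subset h
  have hsub : G ⊆ interior {x | w x = w x₀} := by
    refine h.isConnected.isPreconnected.subset_left_of_subset_union isOpen_interior
      (isOpen_interior (s := {x | w x ≠ w x₀})) ?_ ?_
      ⟨x₀, hx₀, mem_interior_iff_mem_nhds.2 (hloc x₀ hx₀)⟩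
    · exact disjoint_left.2 fun x h1 h2 => hmem h2 (hmem h1)
    · intro x hx
      by_cases hxx : w x = w x₀
      · exact Or.inl (mem_interior_iff_mem_nhds.2 (hxx ▸ hloc x hx))
      · refine Or.inr (mem_interior_iff_mem_nhds.2 ?_)
        filter_upwards [hloc x hx] with y hy
        exact fun hyy => hxx (hy.symm.trans hyy)
  exact ⟨w x₀, fun z hz => hmem (hsub hz), fun hinf => (hmem (hsub hinf)).symm⟩

end LiesRightOf

lemma coe_eq_extendedRoot {p : ℂ[X]} (hp : p ≠ 0) (hd : p.natDegree ≤ 1) {z : ℂ}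
    (hz : p.eval z = 0) : (z : OnePoint ℂ) = extendedRoot p := by
  rw [eq_X_add_C_of_natDegree_le_one hd] at hz
  simp only [eval_add, eval_mul, eval_C, eval_X] at hz
  rcases Nat.le_one_iff_eq_zero_or_eq_one.1 hd with h | h
  · have h1 : p.coeff 1 = 0 := coeff_eq_zero_of_natDegree_lt (by omega)
    rw [h1, zero_mul, zero_add] at hz
    exact absurd (by rw [eq_C_of_natDegree_eq_zero h, hz, C_0]) hp
  · have h1 : p.coeff 1 ≠ 0 := by
      have := leadingCoeff_ne_zero.2 hp
      rwa [leadingCoeff, h] at this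
    rw [extendedRoot, if_neg (by omega)]
    congr 1
    rw [eq_div_iff h1]
    linear_combination hz

lemma coeff_one_ne_zero_of_extendedRoot {p : ℂ[X]} (hd : p.natDegree ≤ 1)
    (h : extendedRoot p ≠ OnePoint.infty) : p.coeff 1 ≠ 0 := by
  have h0 : p.natDegree ≠ 0 := fun h0 => h (by rw [extendedRoot, if_pos h0])
  have h1 : p.natDegree = 1 := by omega
  have h2 : p.leadingCoeff ≠ 0 := leadingCoeff_ne_zero.2 fun hp => h0 (by simp [hp])
  rwa [leadingCoeff, h1] at h2

/-! ### Orthogonality for the inverse of a tridiagonal pencil -/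

/-- The entries `r i j` of a two-sided inverse, holomorphic in the open set `ρ`, of the tridiagonal
pencil with the entries `β`, `-b` and `-a`. If `inf` holds, then `∞` is a regular point, too. -/
structure IsPencilInverse (β a b : ℕ → ℂ[X]) (ρ : Set ℂ) (inf : Prop) (r : ℕ → ℕ → ℂ → ℂ) :
    Prop where
  β_natDegree_le : ∀ n, (β n).natDegree ≤ 1
  a_natDegree_le : ∀ n, (a n).natDegree ≤ 1
  b_natDegree_le : ∀ n, (b n).natDegree ≤ 1
  isOpen : IsOpen ρ
  differentiableOn : ∀ i j, DifferentiableOn ℂ (r i j) ρ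
  inverse : ∀ z ∈ ρ, IsTridiagInverse (fun n => (β n).eval z) (fun n => (a n).eval z)
    (fun n => (b n).eval z) (fun i j => r i j z)
  infty : inf → (∀ᶠ z in cocompact ℂ, z ∈ ρ) ∧ ∃ s : ℕ → ℕ → ℂ,
    IsTridiagInverse (fun n => (β n).coeff 1) (fun n => (a n).coeff 1) (fun n => (b n).coeff 1) s ∧
      ∀ i j, Tendsto (fun z => z * r i j z) (cocompact ℂ) (𝓝 (s i j))

namespace IsPencilInverse

variable {β a b : ℕ → ℂ[X]} {ρ : Set ℂ} {inf : Prop} {r : ℕ → ℕ → ℂ → ℂ}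

/-- Exchanges the roles of `αᴸ` and `αᴿ` and keeps `r 0 0`, hence exchanges the two orthogonality
relations. -/
lemma transpose (h : IsPencilInverse β a b ρ inf r) :
    IsPencilInverse β b a ρ inf (fun i j => r j i) where
  β_natDegree_le := h.β_natDegree_le
  a_natDegree_le := h.b_natDegree_le
  b_natDegree_le := h.a_natDegree_le
  isOpen := h.isOpen
  differentiableOn i j := h.differentiableOn j i
  inverse z hz := (h.inverse z hz).transpose
  infty hi := by
    obtain ⟨h1, s, h2, h3⟩ := h.infty hi
    exact ⟨h1, fun i j => s j i, h2.transpose, fun i j => h3 j i⟩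

/-- The entry `r n 0` of the inverse is divisible by `a_0 ⋯ a_{n-1}`. -/
lemma exists_quotient (h : IsPencilInverse β a b ρ inf r) (n : ℕ) :
    ∃ Y : ℂ → ℂ, DifferentiableOn ℂ Y ρ ∧
      ∀ z ∈ ρ, ∀ j ≤ n, r n j z = Y z * (tridiagDenom β a b n j).eval z := by
  have hex : ∀ z, ∃ j, z ∈ ρ → j ≤ n ∧ (tridiagDenom β a b n j).eval z ≠ 0 := by
    intro z
    by_cases hz : z ∈ ρ
    · obtain ⟨j, hj, hne⟩ := (h.inverse z hz).exists_tridiagDenom_ne_zero n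
      exact ⟨j, fun _ => ⟨hj, by rwa [eval_tridiagDenom]⟩⟩
    · exact ⟨0, fun h => absurd h hz⟩
  choose k hk using hex
  -- The chosen index may jump with `z`, but the quotient does not depend on it; near a given point
  -- one fixed index works, which gives holomorphy.
  let Y : ℂ → ℂ := fun z => r n (k z) z / (tridiagDenom β a b n (k z)).eval z
  have hY : ∀ z ∈ ρ, ∀ j ≤ n, r n j z = Y z * (tridiagDenom β a b n j).eval z := by
    intro z hz j hj
    have := (h.inverse z hz).mul_tridiagDenom (n := n) (hk z hz).1 hj
    rw [← eval_tridiagDenom, ← eval_tridiagDenom] at this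
    have hne := (hk z hz).2
    simp only [Y]
    field_simp
    exact this.symm
  refine ⟨Y, fun z hz => DifferentiableAt.differentiableWithinAt ?_, hY⟩
  obtain ⟨hj, hne⟩ := hk z hz
  have h1 : DifferentiableAt ℂ (fun w => r n (k z) w / (tridiagDenom β a b n (k z)).eval w) z :=
    ((h.differentiableOn n (k z)).differentiableAt (h.isOpen.mem_nhds hz)).fun_div
      (tridiagDenom β a b n (k z)).differentiable.differentiableAt hne
  refine h1.congr_of_eventuallyEq ?_
  filter_upwards [h.isOpen.mem_nhds hz,
    (tridiagDenom β a b n (k z)).continuous.continuousAt.eventually_ne hne] with w hw hwne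
  rw [hY w hw _ hj, mul_div_cancel_right₀ _ hwne]

/-- The quotient of `r n 0` and `a_0 ⋯ a_{n-1}` has a zero of order `n + 1` at `∞`. -/
lemma tendsto_quotient (h : IsPencilInverse β a b ρ inf r) (hi : inf) {n : ℕ} {Y : ℂ → ℂ}
    (hY : ∀ z ∈ ρ, ∀ j ≤ n, r n j z = Y z * (tridiagDenom β a b n j).eval z) {p : ℂ[X]}
    (hp : p.degree < n) : Tendsto (fun z => z * (Y z * p.eval z)) (cocompact ℂ) (𝓝 0) := by
  obtain ⟨hρ, s, hs, hlim⟩ := h.infty hi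
  -- Applied to the inverse of `B`, this gives a denominator of exact degree `n`. As `z * r n j z`
  -- has a finite limit and `p` has degree below `n`, the product tends to zero.
  obtain ⟨j, hj, hne⟩ := hs.exists_tridiagDenom_ne_zero n
  rw [← coeff_tridiagDenom h.β_natDegree_le h.a_natDegree_le h.b_natDegree_le hj] at hne
  have hD := tendsto_eval_div_pow
    (natDegree_tridiagDenom_le h.β_natDegree_le h.a_natDegree_le h.b_natDegree_le hj)
  have hpn := tendsto_eval_div_pow (natDegree_le_of_degree_le hp.le)
  rw [coeff_eq_zero_of_degree_lt hp] at hpn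
  have h1 := (hlim n j).mul (hpn.div hD hne)
  rw [zero_div, mul_zero] at h1
  refine h1.congr' ?_
  filter_upwards [hρ, hD.eventually_ne hne,
    (isCompact_singleton (x := (0 : ℂ))).compl_mem_cocompact] with z hz hDz hz0
  have hz0' : z ≠ 0 := hz0
  have hDz' : (tridiagDenom β a b n j).eval z ≠ 0 := fun h0 => hDz (by rw [h0, zero_div])
  simp only [Pi.div_apply]
  rw [hY z hz j hj]
  field_simp

variable {G : Set (OnePoint ℂ)} {γ : ℝ → ℂ}

lemma contourIntegral_quotient_eq_zero (h : IsPencilInverse β a b ρ (OnePoint.infty ∈ G) r)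
    (hG : LiesRightOf G γ) (hρ : ∀ z : ℂ, (z : OnePoint ℂ) ∈ closure G → z ∈ ρ) {n : ℕ}
    {Y : ℂ → ℂ} (hYd : DifferentiableOn ℂ Y ρ)
    (hY : ∀ z ∈ ρ, ∀ j ≤ n, r n j z = Y z * (tridiagDenom β a b n j).eval z) {p : ℂ[X]}
    (hp : p.degree < n) : contourIntegral γ (fun ζ => Y ζ * p.eval ζ) = 0 := by
  obtain ⟨z₀, hz₀⟩ := hG.exists_coe_mem
  have hw : ∀ w : ℂ, (w : OnePoint ℂ) ∉ closure G →
      windingNumber γ w = windingNumber γ z₀ + 1 := fun w hw => hG.right z₀ w hz₀ hw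
  refine hG.curve.contourIntegral_eq_zero h.isOpen (hYd.mul p.differentiable.differentiableOn)
    (fun z hz => hρ z (hG.trace_subset_closure hz)) (c := windingNumber γ z₀ + 1)
    (fun w hwρ => hw w fun hcl => hwρ (hρ w hcl)) ?_
    ⟨z₀, hρ z₀ (subset_closure hz₀), hG.notMem_trace hz₀⟩
  -- If `∞ ∉ G`, points near `∞` lie outside the closure of `G` and have winding number zero, so the
  -- common value `c` is zero.
  by_cases hi : OnePoint.infty ∈ G
  · exact Or.inr ⟨(h.infty hi).1, h.tendsto_quotient hi hY hp⟩
  · refine Or.inl ?_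
    obtain ⟨w, hw1, hw2⟩ := ((hG.eventually_notMem_closure hi).and
      hG.curve.windingNumber_eventually_eq_zero).exists
    rw [← hw w hw1, hw2]

/-- Integrals of rational functions with all poles in `G`; if `∞ ∉ G`, the function has to vanish to
second order at `∞`. -/
lemma _root_.LiesRightOf.contourIntegral_rational_eq_zero (hG : LiesRightOf G γ) {N D : ℂ[X]}
    (hD : D ≠ 0) (hroots : ∀ z : ℂ, D.eval z = 0 → (z : OnePoint ℂ) ∈ G)
    (hinf : OnePoint.infty ∉ G → ∃ d, D.natDegree ≤ d ∧ D.coeff d ≠ 0 ∧ N.natDegree + 1 < d) :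
    contourIntegral γ (fun ζ => N.eval ζ / D.eval ζ) = 0 := by
  obtain ⟨c, hc, hc0⟩ := hG.exists_windingNumber_eq
  have hU : IsOpen {z : ℂ | D.eval z ≠ 0} := isOpen_ne_fun D.continuous continuous_const
  have hev : ∀ᶠ z in cocompact ℂ, z ∈ {z : ℂ | D.eval z ≠ 0} := by
    filter_upwards [D.roots.toFinset.finite_toSet.isCompact.compl_mem_cocompact] with z hz hz0
    exact hz (by simpa [hD] using hz0)
  refine hG.curve.contourIntegral_eq_zero hU
    (N.differentiable.differentiableOn.fun_div D.differentiable.differentiableOn fun z hz => hz)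
    (fun z hz h0 => hG.notMem_trace (hroots z h0) hz) (c := c)
    (fun w hw => hc w (hroots w (not_not.1 hw))) ?_
    (hev.and hG.curve.isCompact_trace.compl_mem_cocompact).exists
  by_cases hi : OnePoint.infty ∈ G
  · exact Or.inl (hc0 hi)
  · refine Or.inr ⟨hev, ?_⟩
    obtain ⟨d, hDd, hne, hNd⟩ := hinf hi
    have hXN : (X * N).natDegree < d := by
      have := natDegree_mul_le (p := (X : ℂ[X])) (q := N)
      rw [natDegree_X] at this
      omega
    have h1 := (tendsto_eval_div_pow hXN.le).div (tendsto_eval_div_pow hDd) hne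
    rw [coeff_eq_zero_of_natDegree_lt hXN, zero_div] at h1
    refine h1.congr' ?_
    filter_upwards [hev, (isCompact_singleton (x := (0 : ℂ))).compl_mem_cocompact] with z hz hz0
    have hz0' : z ≠ 0 := hz0
    have hz' : D.eval z ≠ 0 := hz
    simp only [Pi.div_apply, eval_mul, eval_X]
    field_simp

/-- The orthogonality relation, and the continuity of its integrand. -/
theorem orthogonality (h : IsPencilInverse β a b ρ (OnePoint.infty ∈ G) r)
    (hG : LiesRightOf G γ) (hρ : ∀ z : ℂ, (z : OnePoint ℂ) ∈ closure G → z ∈ ρ)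
    (ha0 : ∀ k, a k ≠ 0) (hb0 : ∀ k, b k ≠ 0)
    (ha : ∀ k, extendedRoot (a k) ∈ G) (hb : ∀ k, extendedRoot (b k) ∈ G)
    {n : ℕ} (hn : 1 ≤ n) {p : ℂ[X]} (hp : p.degree < n) :
    ContinuousOn (fun ζ => (tridiagContinuant β a b n).eval ζ /
        (∏ k ∈ Finset.range n, (b k).eval ζ) *
          (p.eval ζ / ∏ k ∈ Finset.range n, (a k).eval ζ)) (curveTrace γ) ∧
      contourIntegral γ (fun ζ => (tridiagContinuant β a b n).eval ζ /
        (∏ k ∈ Finset.range n, (b k).eval ζ) *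
          (p.eval ζ / ∏ k ∈ Finset.range n, (a k).eval ζ) * r 0 0 ζ) = 0 := by
  have hroot : ∀ (f : ℕ → ℂ[X]), (∀ k, f k ≠ 0) → (∀ k, (f k).natDegree ≤ 1) →
      (∀ k, extendedRoot (f k) ∈ G) → ∀ z : ℂ, (∏ k ∈ Finset.range n, f k).eval z = 0 →
      (z : OnePoint ℂ) ∈ G := by
    intro f h0 h1 h2 z hz
    rw [eval_prod, Finset.prod_eq_zero_iff] at hz
    obtain ⟨k, -, hk⟩ := hz
    rw [coe_eq_extendedRoot (h0 k) (h1 k) hk]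
    exact h2 k
  have hcard : ∀ f : ℕ → ℂ[X], (∀ k, (f k).natDegree ≤ 1) →
      (∏ k ∈ Finset.range n, f k).natDegree ≤ n ∧
        (∏ k ∈ Finset.range n, f k).coeff n = ∏ k ∈ Finset.range n, (f k).coeff 1 := fun f hf => by
    have h1 := natDegree_prod_le_card (Finset.range n) hf
    have h2 := coeff_prod_card (Finset.range n) hf
    rw [Finset.card_range] at h1 h2
    exact ⟨h1, h2⟩
  have hra := hroot a ha0 h.a_natDegree_le ha
  have hrb := hroot b hb0 h.b_natDegree_le hb
  simp only [← eval_prod]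
  set PA := ∏ k ∈ Finset.range n, a k with hPA
  set PB := ∏ k ∈ Finset.range n, b k with hPB
  have hneA : ∀ ζ ∈ curveTrace γ, PA.eval ζ ≠ 0 := fun ζ hζ h0 => hG.notMem_trace (hra ζ h0) hζ
  have hneB : ∀ ζ ∈ curveTrace γ, PB.eval ζ ≠ 0 := fun ζ hζ h0 => hG.notMem_trace (hrb ζ h0) hζ
  have hdiv : ∀ P Q : ℂ[X], (∀ ζ ∈ curveTrace γ, Q.eval ζ ≠ 0) →
      ContinuousOn (fun ζ => P.eval ζ / Q.eval ζ) (curveTrace γ) := fun P Q hQ =>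
    P.continuous.continuousOn.div Q.continuous.continuousOn hQ
  refine ⟨(hdiv _ _ hneB).mul (hdiv _ _ hneA), ?_⟩
  obtain ⟨Y, hYd, hY⟩ := h.exists_quotient n
  have hΓρ : curveTrace γ ⊆ ρ := fun z hz => hρ z (hG.trace_subset_closure hz)
  -- The remainder formula for the convergent, with `r n 0 = Y * PA`: the first summand is
  -- holomorphic around the closure of `G`, the second has its finite poles inside `G`.
  have hsplit : contourIntegral γ (fun ζ => (tridiagContinuant β a b n).eval ζ / PB.eval ζ *
      (p.eval ζ / PA.eval ζ) * r 0 0 ζ) = contourIntegral γ (fun ζ => Y ζ * p.eval ζ +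
        (tridiagNumerator β a b n * p).eval ζ / (PA * PB).eval ζ) := by
    refine IsClosedACCurve.contourIntegral_congr fun ζ hζ => ?_
    have h1 := (h.inverse ζ (hΓρ hζ)).continuant_mul n
    rw [← eval_tridiagContinuant, ← eval_tridiagNumerator, ← eval_prod, ← hPB,
      hY ζ (hΓρ hζ) 0 n.zero_le, tridiagDenom, tridiagContinuant, one_mul,
      ← Finset.range_eq_Ico, ← hPA] at h1
    have hA := hneA ζ hζ
    have hB := hneB ζ hζ
    simp only [eval_mul]
    field_simp
    linear_combination p.eval ζ * h1
  have hneAB : ∀ ζ ∈ curveTrace γ, (PA * PB).eval ζ ≠ 0 := fun ζ hζ => by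
    rw [eval_mul]
    exact mul_ne_zero (hneA ζ hζ) (hneB ζ hζ)
  rw [hsplit, hG.curve.contourIntegral_add (φ := fun ζ => Y ζ * p.eval ζ)
      (ψ := fun ζ => (tridiagNumerator β a b n * p).eval ζ / (PA * PB).eval ζ)
      ((hYd.continuousOn.mono hΓρ).mul p.continuous.continuousOn) (hdiv _ _ hneAB),
    h.contourIntegral_quotient_eq_zero hG hρ hYd hY hp, zero_add]
  refine hG.contourIntegral_rational_eq_zero (mul_ne_zero
    (Finset.prod_ne_zero_iff.2 fun k _ => ha0 k) (Finset.prod_ne_zero_iff.2 fun k _ => hb0 k))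
    (fun z hz => ?_) fun hi => ⟨n + n, ?_, ?_, ?_⟩
  · rw [eval_mul, mul_eq_zero] at hz
    exact hz.elim (hra z) (hrb z)
  · exact natDegree_mul_le_of_le (hcard a h.a_natDegree_le).1 (hcard b h.b_natDegree_le).1
  · rw [coeff_mul_add_eq_of_natDegree_le (hcard a h.a_natDegree_le).1
      (hcard b h.b_natDegree_le).1, (hcard a h.a_natDegree_le).2, (hcard b h.b_natDegree_le).2]
    refine mul_ne_zero (Finset.prod_ne_zero_iff.2 fun k _ => ?_)
      (Finset.prod_ne_zero_iff.2 fun k _ => ?_)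
    · exact coeff_one_ne_zero_of_extendedRoot (h.a_natDegree_le k) fun h0 => hi (h0 ▸ ha k)
    · exact coeff_one_ne_zero_of_extendedRoot (h.b_natDegree_le k) fun h0 => hi (h0 ▸ hb k)
  -- Two factors of degree at most `n - 1` against `2n`; the truncated subtraction is harmless
  -- because `1 ≤ n`.
  · have h1 := natDegree_tridiagNumerator_le h.β_natDegree_le h.a_natDegree_le h.b_natDegree_le n
    have h2 : p.natDegree ≤ n - 1 := natDegree_le_iff_coeff_eq_zero.2 fun N hN =>
      coeff_eq_zero_of_degree_lt (hp.trans_le (by exact_mod_cast (by omega : n ≤ N)))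
    have h3 := natDegree_mul_le_of_le h1 h2
    omega

end IsPencilInverse

/-! ### Application to the continued fraction -/

namespace MPFraction

open MPPencil

variable (F : MPFraction)

lemma isPencilInverse {inf : Prop} (hinf : inf → IsUnit F.opB) :
    IsPencilInverse F.β F.αL F.αR F.resolventSet inf F.resolventEntry where
  β_natDegree_le := F.β_natDegree_le
  a_natDegree_le := F.αL_natDegree_le
  b_natDegree_le := F.αR_natDegree_le
  isOpen := F.isOpen_resolventSet
  differentiableOn := F.differentiableOn_resolventEntry
  inverse _ hz := F.isTridiagInverse_resolventEntry hz
  infty hi := ⟨(F.tendsto_smul_inverse (hinf hi)).1, F.invBEntry,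
    F.isTridiagInverse_invBEntry (hinf hi), F.tendsto_mul_resolventEntry (hinf hi)⟩

lemma coe_mem_extendedResolventSet {z : ℂ} (h : (z : OnePoint ℂ) ∈ F.extendedResolventSet) :
    z ∈ F.resolventSet := by
  rcases h with ⟨w, hw, hwz⟩ | h
  · rwa [← OnePoint.coe_injective hwz]
  · exact absurd h.1 (OnePoint.coe_ne_infty z)

lemma infty_mem_extendedResolventSet (h : OnePoint.infty ∈ F.extendedResolventSet) :
    IsUnit F.opB := by
  rcases h with ⟨w, -, hw⟩ | h
  · exact absurd hw (OnePoint.coe_ne_infty w)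
  · exact h.2

lemma continuousOn_m : ContinuousOn F.m F.resolventSet :=
  (F.differentiableOn_resolventEntry 0 0).continuousOn.congr fun z _ => F.m_eq z

end MPFraction

end

theorem theorem2p5 (F : MPFraction) (γ : ℝ → ℂ) (Γext : Set (OnePoint ℂ))
    (hγ : IsJordanParam γ)
    (hopen : IsOpen Γext) (hconn : IsConnected Γext)
    (hfrontier : frontier Γext = ((↑) : ℂ → OnePoint ℂ) '' curveTrace γ)
    (hright : HasOnRight γ Γext)
    (hL : ∀ k, extendedRoot (F.αL k) ∈ Γext)
    (hR : ∀ k, extendedRoot (F.αR k) ∈ Γext)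
    (hclosure : closure Γext ⊆ F.extendedResolventSet) :
    -- the functional is well defined and linear on the continuous functions on the curve
    (∀ g : ℂ → ℂ, ContinuousOn g (curveTrace γ) →
      IntervalIntegrable (fun t => g (γ t) * F.m (γ t) * deriv γ t) volume 0 1) ∧
    (∀ (c : ℂ) (g h : ℂ → ℂ), ContinuousOn g (curveTrace γ) → ContinuousOn h (curveTrace γ) →
      F.functionalS γ (fun ζ => c * g ζ + h ζ) = c * F.functionalS γ g + F.functionalS γ h) ∧
    -- the biorthogonality relations
    ∀ n : ℕ, 1 ≤ n → ∀ p : ℂ[X], p.degree < n →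
      (ContinuousOn
          (fun ζ => F.qR n ζ * (p.eval ζ / ∏ k ∈ Finset.range n, (F.αL k).eval ζ)) (curveTrace γ) ∧
        F.functionalS γ
          (fun ζ => F.qR n ζ * (p.eval ζ / ∏ k ∈ Finset.range n, (F.αL k).eval ζ)) = 0) ∧
      (ContinuousOn
          (fun ζ => (p.eval ζ / ∏ k ∈ Finset.range n, (F.αR k).eval ζ) * F.qL n ζ) (curveTrace γ) ∧
        F.functionalS γ
          (fun ζ => (p.eval ζ / ∏ k ∈ Finset.range n, (F.αR k).eval ζ) * F.qL n ζ) = 0) := by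
  have hG : LiesRightOf Γext γ := ⟨hγ.isClosedACCurve, hopen, hconn, hfrontier, hright⟩
  have hρ : ∀ z : ℂ, (z : OnePoint ℂ) ∈ closure Γext → z ∈ F.resolventSet := fun z hz =>
    F.coe_mem_extendedResolventSet (hclosure hz)
  have hm : ContinuousOn F.m (curveTrace γ) :=
    F.continuousOn_m.mono fun z hz => hρ z (hG.trace_subset_closure hz)
  have hF : IsPencilInverse F.β F.αL F.αR F.resolventSet (OnePoint.infty ∈ Γext)
      F.resolventEntry := F.isPencilInverse fun hi =>
    F.infty_mem_extendedResolventSet (hclosure (subset_closure hi))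
  refine ⟨fun g hg => hG.curve.intervalIntegrable (hg.mul hm), fun c g h hg hh => ?_,
    fun n hn p hp => ⟨?_, ?_⟩⟩
  · have h1 : (fun ζ => (c * g ζ + h ζ) * F.m ζ) =
        fun ζ => c * (g ζ * F.m ζ) + h ζ * F.m ζ := by
      ext ζ
      ring
    simp only [MPFraction.functionalS]
    rw [h1, hG.curve.contourIntegral_add (φ := fun ζ => c * (g ζ * F.m ζ))
      (ψ := fun ζ => h ζ * F.m ζ) (continuousOn_const.mul (hg.mul hm)) (hh.mul hm),
      IsClosedACCurve.contourIntegral_const_mul]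
    ring
  · obtain ⟨h1, h2⟩ := hF.orthogonality hG hρ F.αL_ne_zero F.αR_ne_zero hL hR hn hp
    simp only [MPFraction.functionalS, MPFraction.qR, F.q_eq_tridiagContinuant, F.m_eq]
    exact ⟨h1, by rw [h2, mul_zero]⟩
  -- The continuants depend only on the products `αᴸ αᴿ`, so `q_n` is unchanged under transposition.
  · obtain ⟨h1, h2⟩ := hF.transpose.orthogonality hG hρ F.αR_ne_zero F.αL_ne_zero hR hL hn hp
    simp only [MPFraction.functionalS, MPFraction.qL, F.q_eq_tridiagContinuant, F.m_eq,
      tridiagContinuant_swap F.β F.αL F.αR, mul_comm (_ / ∏ k ∈ Finset.range n, (F.αR k).eval _)]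
    exact ⟨h1, by rw [h2, mul_zero]⟩
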